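/- Fix $h>0$, write $h\mathbb Z^+=\{0,h,2h,\dots\}$, and let $m$ be a probability measure on $\mathcal X=(-h\mathbb Z^+)\times h\mathbb Z\times h\mathbb Z^+\times\{-1,+1\}$, with generic point $(I,X,S,\sigma)$. For a random variable $Y$ and an event $A$ on $\mathcal X$, write $m(Y;A)=\int_A Y\,dm$. Call $m$ *consistent* if there are a probability space with a filtration $(\mathcal F_t)_{t\in h\mathbb Z^+}$, a symmetric simple random walk $(\xi_t)_{t\in h\mathbb Z^+}$ on $h\mathbb Z$ relative to $(\mathcal F_t)$ (that is, $\xi$ is adapted, $\xi_0=0$, and each increment $\xi_{t+h}-\xi_t$ is independent of $\mathcal F_t$ and equals $\pm h$ with probability $\tfrac12$ each; the filtration may be larger than that generated by $\xi$) and an almost surely finite $(\mathcal F_t)$-stopping time $T$ such that $m$ is the law of $(I_T,\xi_T,S_T,\sigma_T)$. Here $I_t=\min_{s\le t}\xi_s$, $S_t=\max_{s\le t}\xi_s$, and the signature is $\sigma_t=+1$ if $g^+_t>g^-_t$ and $\sigma_t=-1$ otherwise, where $g^+_t$ and $g^-_t$ are the first times at which the maximum $S_t$, respectively the minimum $I_t$,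 over $[0,t]$ is attained. In particular $\sigma_0=-1$. For $a,b\in h\mathbb Z^+$ not both zero put $$\varphi(b,-a)=\frac{a-m(a+X;\,S<b,\,I>-a)}{a+b},\qquad \varphi(-a,b)=\frac{b-m(b-X;\,S<b,\,I>-a)}{a+b},$$ $$\psi_+(-a,b)=\varphi(b,-a-h)-\varphi(b,-a),\qquad \psi_-(-a,b)=\varphi(-a,b+h)-\varphi(-a,b),$$ $$p_{\pm0}=m(S=b,\,I=-a,\,\sigma=\pm1),\qquad v_\pm=m(X\mid S=b,\,I=-a,\,\sigma=\pm1).$$ Then $m$ is consistent if and only if the following three conditions hold: 1. $m(I\le X\le S)=1$; 2. for all $a,b\in h\mathbb Z^+$ not both zero, $$\frac{p_{+0}}{\psi_+(-a,b)}\le\frac{h}{b+h-v_+}\qquad\text{and}\qquad\frac{p_{-0}}{\psi_-(-a,b)}\le\frac{h}{a+h+v_-},$$ where, if the denominator $\psi_\pm(-a,b)$ is zero, the inequality is understood in the cross-multiplied form, $p_{+0}\,(b+h-v_+)\le h\,\psi_+(-a,b)$, respectively $p_{-0}\,(a+h+v_-)\le h\,\psi_-(-a,b)$ (when $p_{\pm0}=0$,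 the value given to $v_\pm$ is immaterial and is taken to be $0$); 3. $m(I=S=0,\,\sigma=+1)=0$. -/

import Mathlib

open MeasureTheory ProbabilityTheory

universe u

namespace StoppedWalk

noncomputable section

/-! ### The state space -/

/-- Quadruples `(I, X, S, σ)` = (minimum, final value, maximum, signature);
the signature takes values in `ℤˣ = {1, -1}`. -/
abbrev Quad : Type := ℝ × ℝ × ℝ × ℤˣ

/-- The minimum `I`. -/
abbrev Quad.I (z : Quad) : ℝ := z.1

/-- The final value `X`. -/
abbrev Quad.X (z : Quad) : ℝ := z.2.1

/-- The maximum `S`. -/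
abbrev Quad.S (z : Quad) : ℝ := z.2.2.1

/-- The signature `σ`. -/
abbrev Quad.sig (z : Quad) : ℤˣ := z.2.2.2

/-- The set `(-hℤ⁺) × hℤ × hℤ⁺ × {-1, +1}`. -/
def stateSpace (h : ℝ) : Set Quad :=
  {z | (∃ i : ℕ, z.I = -(i * h)) ∧ (∃ k : ℤ, z.X = k * h) ∧ (∃ j : ℕ, z.S = j * h)}

/-! ### Symmetric simple random walk and its path functionals

Time `n : ℕ` stands for the grid time `n * h`. -/

/-- `ξ` is a symmetric simple random walk on the grid `hℤ`, started at `0`, relative to the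
filtration `ℱ`, which may be larger than the filtration generated by `ξ`: the process is adapted,
and each increment is independent of the past and is `±h` with probability `1/2` each. -/
structure IsSymmetricSimpleRandomWalk {Ω : Type*} {mΩ : MeasurableSpace Ω} (P : Measure Ω)
    (h : ℝ) (ℱ : Filtration ℕ mΩ) (ξ : ℕ → Ω → ℝ) : Prop where
  adapted : Adapted ℱ ξ
  start : ∀ᵐ ω ∂P, ξ 0 ω = 0
  indep : ∀ n, Indep (MeasurableSpace.comap (fun ω => ξ (n + 1) ω - ξ n ω) inferInstance) (ℱ n) P
  step_up : ∀ n, P {ω | ξ (n + 1) ω - ξ n ω = h} = 1 / 2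
  step_down : ∀ n, P {ω | ξ (n + 1) ω - ξ n ω = -h} = 1 / 2

/-- Running maximum `S_n = max_{k ≤ n} x_k` of a path. -/
def runMax (x : ℕ → ℝ) (n : ℕ) : ℝ :=
  (Finset.range (n + 1)).sup' Finset.nonempty_range_add_one x

/-- Running minimum `I_n = min_{k ≤ n} x_k` of a path. -/
def runMin (x : ℕ → ℝ) (n : ℕ) : ℝ :=
  (Finset.range (n + 1)).inf' Finset.nonempty_range_add_one x

/-- `g⁺_n`: the first time at which the maximum over `[0, n]` is attained. -/
def gPlus (x : ℕ → ℝ) (n : ℕ) : ℕ := sInf {u | u ≤ n ∧ x u = runMax x n}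

/-- `g⁻_n`: the first time at which the minimum over `[0, n]` is attained. -/
def gMinus (x : ℕ → ℝ) (n : ℕ) : ℕ := sInf {u | u ≤ n ∧ x u = runMin x n}

/-- The signature: `+1` if `g⁺_n > g⁻_n`, and `-1` otherwise. -/
def signature (x : ℕ → ℝ) (n : ℕ) : ℤˣ := if gMinus x n < gPlus x n then 1 else -1

/-- The process `n ↦ (I_n, ξ_n, S_n, σ_n)`. -/
def quadProcess {Ω : Type*} (ξ : ℕ → Ω → ℝ) (n : ℕ) (ω : Ω) : Quad :=
  (runMin (fun k => ξ k ω) n, ξ n ω, runMax (fun k => ξ k ω) n, signature (fun k => ξ k ω) n)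

/-- `m` is consistent: it is the law of `(I_T, X_T, S_T, σ_T)` for some symmetric simple random
walk on `hℤ`, relative to some filtration on some probability space, and some almost surely finite
stopping time `T`. -/
def IsConsistent (h : ℝ) (m : Measure Quad) : Prop :=
  ∃ (Ω : Type u) (mΩ : MeasurableSpace Ω) (P : Measure Ω) (ℱ : Filtration ℕ mΩ)
    (ξ : ℕ → Ω → ℝ) (T : Ω → WithTop ℕ),
    IsProbabilityMeasure P ∧ IsSymmetricSimpleRandomWalk P h ℱ ξ ∧
    IsStoppingTime ℱ T ∧ (∀ᵐ ω ∂P, T ω ≠ ⊤) ∧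
    P.map (stoppedValue (quadProcess ξ) T) = m

/-! ### The algebraic expressions in `m` -/

/-- `φ(b, -a) = (a - m(a + X; S < b, I > -a)) / (a + b)`. -/
def phiUp (m : Measure Quad) (a b : ℝ) : ℝ :=
  (a - ∫ z in {z : Quad | z.S < b ∧ -a < z.I}, (a + z.X) ∂m) / (a + b)

/-- `φ(-a, b) = (b - m(b - X; S < b, I > -a)) / (a + b)`. -/
def phiDown (m : Measure Quad) (a b : ℝ) : ℝ :=
  (b - ∫ z in {z : Quad | z.S < b ∧ -a < z.I}, (b - z.X) ∂m) / (a + b)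

/-- `ψ₊(-a, b) = φ(b, -a - h) - φ(b, -a)`. -/
def psiPlus (h : ℝ) (m : Measure Quad) (a b : ℝ) : ℝ := phiUp m (a + h) b - phiUp m a b

/-- `ψ₋(-a, b) = φ(-a, b + h) - φ(-a, b)`. -/
def psiMinus (h : ℝ) (m : Measure Quad) (a b : ℝ) : ℝ := phiDown m a (b + h) - phiDown m a b

/-- The event `S = b, I = -a, σ = s`. -/
def cell (a b : ℝ) (s : ℤˣ) : Set Quad := {z | z.S = b ∧ z.I = -a ∧ z.sig = s}

/-- `p_{±0} = m(S = b, I = -a, σ = ±1)`. -/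
def pZero (m : Measure Quad) (a b : ℝ) (s : ℤˣ) : ℝ := m.real (cell a b s)

/-- `v_± = m(X | S = b, I = -a, σ = ±1)`; when the event has mass `0` the value is immaterial,
and is `0` here. -/
def condMean (m : Measure Quad) (a b : ℝ) (s : ℤˣ) : ℝ :=
  (∫ z in cell a b s, z.X ∂m) / pZero m a b s

/-- The inequality `x / p ≤ h / d`, understood in the cross-multiplied form `x * d ≤ h * p`
if `p = 0`. -/
def RatioLE (x p h d : ℝ) : Prop :=
  (p ≠ 0 → x / p ≤ h / d) ∧ (p = 0 → x * d ≤ h * p)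

/-- `p_{+0} / ψ₊(-a, b) ≤ h / (b + h - v₊)`. -/
def CondPlus (h : ℝ) (m : Measure Quad) (a b : ℝ) : Prop :=
  RatioLE (pZero m a b 1) (psiPlus h m a b) h (b + h - condMean m a b 1)

/-- `p_{-0} / ψ₋(-a, b) ≤ h / (a + h + v₋)`. -/
def CondMinus (h : ℝ) (m : Measure Quad) (a b : ℝ) : Prop :=
  RatioLE (pZero m a b (-1)) (psiMinus h m a b) h (a + h + condMean m a b (-1))

end

end StoppedWalk

namespace StoppedWalk

/-! ### One-step dynamics of the quadruple -/

/-! Measure levels in units of `h` and call a cell the set of states with given minimum `-i`,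
maximum `j` and signature. The signature records whether the latest record was a maximum or a
minimum. Inside a cell the walk is a simple random walk on `i + j + 1` levels. A plus cell is
entered only at its top, by a new maximum; a minus cell only at its bottom, by a new minimum, except
that the walk starts in the minus cell `(0, 0)`. A cell is left upwards into the plus cell `(i, j +
1)` or downwards into the minus cell `(i + 1, j)`, and never revisited. By optional stopping in the
window `S < b, I > -a`, `φ(b, -a)` is the probability that the walk, run up to `T`, reaches `b`
before `-a`. So `ψ₊` and `ψ₋` are the fluxes entering the plus and minus cells.

Fix a plus cell with `L = i + j`, stopped masses `μ u` and entry flux `E`. The flow `K u` that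
passes through level `u` without stopping solves `K u + μ u = (K (u - 1) + K (u + 1)) / 2` with `K
(-1) = 0` and `K (L + 1) = 2 E`. If `p = K 0 / 2` is the flux leaving at the bottom, this forces `E
= p (L + 2) + ∑ μ u (L + 1 - u)`. Condition 2 in cross-multiplied form says exactly `p ≥ 0`. Minus
cells are the mirror image.

Necessity (`integral_cellPlus_le`, `integral_cellMinus_le`): the weight `b + h - X` on the cell,
compensated by two normalized window functions, is bounded and superharmonic, so its mean under the
stopped law is at most its value at the origin.

Sufficiency: the ratio inequality says nothing when `ψ` is negative, so entry fluxes are shown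
nonnegative by induction on `i + j` (`EmbeddingConditions.entry_nonneg`). Then all exit fluxes and
flows are nonnegative and balance (`EmbeddingConditions.isFlow`). Stopping at each visit to a state
with probability mass / (flow + mass), by independent uniform seeds, realizes `m`
(`IsFlow.stopProb_mul_tsum`, `IsFlow.isConsistent`). -/

theorem le_runMax (x : ℕ → ℝ) {k n : ℕ} (hk : k ≤ n) : x k ≤ runMax x n :=
  Finset.le_sup' x (Finset.mem_range.2 (by omega))

theorem runMin_le (x : ℕ → ℝ) {k n : ℕ} (hk : k ≤ n) : runMin x n ≤ x k :=
  Finset.inf'_le x (Finset.mem_range.2 (by omega))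

theorem exists_eq_runMax (x : ℕ → ℝ) (n : ℕ) : ∃ k, k ≤ n ∧ x k = runMax x n := by
  obtain ⟨k, hk, h⟩ := Finset.exists_mem_eq_sup' (Finset.nonempty_range_add_one (n := n)) x
  exact ⟨k, by simpa [Nat.lt_succ_iff] using hk, h.symm⟩

theorem exists_eq_runMin (x : ℕ → ℝ) (n : ℕ) : ∃ k, k ≤ n ∧ x k = runMin x n := by
  obtain ⟨k, hk, h⟩ := Finset.exists_mem_eq_inf' (Finset.nonempty_range_add_one (n := n)) x
  exact ⟨k, by simpa [Nat.lt_succ_iff] using hk, h.symm⟩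

theorem runMax_neg (x : ℕ → ℝ) (n : ℕ) : runMax (fun k => -x k) n = -runMin x n := by
  obtain ⟨k, hk, h⟩ := exists_eq_runMax (fun k => -x k) n
  obtain ⟨l, hl, h'⟩ := exists_eq_runMin x n
  have h1 := le_runMax (fun k => -x k) hl
  have h2 := runMin_le x hk
  linarith

theorem gMinus_eq_gPlus_neg (x : ℕ → ℝ) (n : ℕ) : gMinus x n = gPlus (fun k => -x k) n := by
  simp [gMinus, gPlus, runMax_neg]

theorem runMax_succ (x : ℕ → ℝ) (n : ℕ) : runMax x (n + 1) = max (runMax x n) (x (n + 1)) := by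
  apply le_antisymm
  · obtain ⟨k, hk, h⟩ := exists_eq_runMax x (n + 1)
    rw [← h]
    rcases Nat.le_succ_iff.1 hk with hk | rfl
    · exact le_max_of_le_left (le_runMax x hk)
    · exact le_max_right _ _
  · obtain ⟨k, hk, h⟩ := exists_eq_runMax x n
    exact max_le (h ▸ le_runMax x (by omega)) (le_runMax x le_rfl)

theorem runMin_eq_neg (x : ℕ → ℝ) (n : ℕ) : runMin x n = -runMax (fun k => -x k) n := by
  simp [runMax_neg]

theorem runMin_succ (x : ℕ → ℝ) (n : ℕ) : runMin x (n + 1) = min (runMin x n) (x (n + 1)) := by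
  rw [runMin_eq_neg, runMin_eq_neg, runMax_succ, max_def, min_def]
  split_ifs <;> linarith

theorem gPlus_le (x : ℕ → ℝ) (n : ℕ) : gPlus x n ≤ n := by
  obtain ⟨k, hk, h⟩ := exists_eq_runMax x n
  exact (Nat.sInf_le (show k ∈ {u | u ≤ n ∧ x u = runMax x n} from ⟨hk, h⟩)).trans hk

theorem gPlus_succ_of_lt {x : ℕ → ℝ} {n : ℕ} (hx : runMax x n < x (n + 1)) :
    gPlus x (n + 1) = n + 1 := by
  refine le_antisymm (gPlus_le _ _) (le_csInf ?_ ?_)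
  · exact exists_eq_runMax x (n + 1)
  · rintro k ⟨hk, h⟩
    rw [runMax_succ, max_eq_right hx.le] at h
    by_contra hlt
    have := le_runMax x (show k ≤ n by omega)
    linarith

theorem gPlus_succ_of_le {x : ℕ → ℝ} {n : ℕ} (hx : x (n + 1) ≤ runMax x n) :
    gPlus x (n + 1) = gPlus x n := by
  have hM : runMax x (n + 1) = runMax x n := by rw [runMax_succ, max_eq_left hx]
  have hmem : gPlus x n ∈ {u | u ≤ n ∧ x u = runMax x n} := Nat.sInf_mem (exists_eq_runMax x n)
  refine le_antisymm (Nat.sInf_le ⟨by have := hmem.1; omega, by rw [hM]; exact hmem.2⟩)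
    (le_csInf (exists_eq_runMax x (n + 1)) ?_)
  rintro k ⟨hk, h⟩
  rw [hM] at h
  by_cases hkn : k ≤ n
  · exact Nat.sInf_le ⟨hkn, h⟩
  · have := gPlus_le x n
    omega

theorem gMinus_le (x : ℕ → ℝ) (n : ℕ) : gMinus x n ≤ n := by
  rw [gMinus_eq_gPlus_neg]; exact gPlus_le _ _

theorem gMinus_succ_of_lt {x : ℕ → ℝ} {n : ℕ} (hx : x (n + 1) < runMin x n) :
    gMinus x (n + 1) = n + 1 := by
  rw [gMinus_eq_gPlus_neg]; exact gPlus_succ_of_lt (by rw [runMax_neg]; linarith)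

theorem gMinus_succ_of_le {x : ℕ → ℝ} {n : ℕ} (hx : runMin x n ≤ x (n + 1)) :
    gMinus x (n + 1) = gMinus x n := by
  rw [gMinus_eq_gPlus_neg, gMinus_eq_gPlus_neg]
  exact gPlus_succ_of_le (by rw [runMax_neg]; linarith)

/-- The quadruple after an increment `d` of the path. -/
noncomputable def stepQuad (z : Quad) (d : ℝ) : Quad :=
  if z.S < z.X + d then (z.I, z.X + d, z.X + d, 1)
  else if z.X + d < z.I then (z.X + d, z.X + d, z.S, -1)
  else (z.I, z.X + d, z.S, z.sig)

theorem stepQuad_mk (I X S : ℝ) (s : ℤˣ) (d : ℝ) : stepQuad (I, X, S, s) d =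
    if S < X + d then (I, X + d, X + d, 1)
    else if X + d < I then (X + d, X + d, S, -1) else (I, X + d, S, s) := rfl

theorem quadProcess_zero {Ω : Type*} (ξ : ℕ → Ω → ℝ) (ω : Ω) :
    quadProcess ξ 0 ω = (ξ 0 ω, ξ 0 ω, ξ 0 ω, -1) := by
  have h1 := gPlus_le (fun k => ξ k ω) 0
  simp [quadProcess, runMin, runMax, signature]
  omega

/-- A strict new record moves `g⁺` or `g⁻` to the current time, which makes it the larger of the
two; without a record both stay put. Hence the signature names the kind of the latest record, and
the quadruple evolves as a function of itself and the increment. -/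
theorem quadProcess_succ {Ω : Type*} (ξ : ℕ → Ω → ℝ) (n : ℕ) (ω : Ω) :
    quadProcess ξ (n + 1) ω = stepQuad (quadProcess ξ n ω) (ξ (n + 1) ω - ξ n ω) := by
  have key : ∀ x : ℕ → ℝ, (runMin x (n + 1), x (n + 1), runMax x (n + 1), signature x (n + 1)) =
      stepQuad (runMin x n, x n, runMax x n, signature x n) (x (n + 1) - x n) := by
    intro x
    have h1 : runMin x n ≤ x n := runMin_le x le_rfl
    have h2 : x n ≤ runMax x n := le_runMax x le_rfl
    simp only [stepQuad, Quad.S, Quad.I, Quad.X, Quad.sig, add_sub_cancel, signature]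
    rw [runMax_succ, runMin_succ]
    by_cases hS : runMax x n < x (n + 1)
    · have := gMinus_le x n
      rw [if_pos hS, gPlus_succ_of_lt hS, gMinus_succ_of_le (by linarith), if_pos (by omega),
        min_eq_left (by linarith), max_eq_right hS.le]
    · rw [if_neg hS, gPlus_succ_of_le (not_lt.1 hS), max_eq_left (not_lt.1 hS)]
      by_cases hI : x (n + 1) < runMin x n
      · have := gPlus_le x n
        rw [if_pos hI, gMinus_succ_of_lt hI, if_neg (by omega), min_eq_right hI.le]
      · rw [if_neg hI, gMinus_succ_of_le (not_lt.1 hI), min_eq_left (not_lt.1 hI)]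
  exact key fun k => ξ k ω

theorem measurable_stepQuad : Measurable fun p : Quad × ℝ => stepQuad p.1 p.2 := by
  unfold stepQuad Quad.S Quad.X Quad.I Quad.sig
  refine Measurable.ite (measurableSet_lt (by fun_prop) (by fun_prop)) (by fun_prop) ?_
  exact Measurable.ite (measurableSet_lt (by fun_prop) (by fun_prop)) (by fun_prop) (by fun_prop)

/-! ### Lattice states -/

/-- A lattice state `(a, b, u, σ)`: minimum `-a`, maximum `b`, position `u - a`, signature `σ`,
in units of `h`. It is meaningful if `u ≤ a + b`. -/
abbrev LatticeState : Type := ℕ × ℕ × ℕ × ℤˣ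

/-- The position lies between the minimum and the maximum. -/
def LatticeState.Valid (d : LatticeState) : Prop := d.2.2.1 ≤ d.1 + d.2.1

/-- The quadruple described by a lattice state. -/
noncomputable def LatticeState.toQuad (h : ℝ) (d : LatticeState) : Quad :=
  (-(d.1 * h), (d.2.2.1 - d.1 : ℝ) * h, d.2.1 * h, d.2.2.2)

/-- The state after an upward step. -/
def LatticeState.up (d : LatticeState) : LatticeState :=
  if d.2.2.1 < d.1 + d.2.1 then (d.1, d.2.1, d.2.2.1 + 1, d.2.2.2)
  else (d.1, d.2.1 + 1, d.2.2.1 + 1, 1)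

/-- The state after a downward step. -/
def LatticeState.down (d : LatticeState) : LatticeState :=
  if 0 < d.2.2.1 then (d.1, d.2.1, d.2.2.1 - 1, d.2.2.2)
  else (d.1 + 1, d.2.1, 0, -1)

/-- The initial state. -/
def LatticeState.origin : LatticeState := (0, 0, 0, -1)

open LatticeState

theorem LatticeState.Valid.up {d : LatticeState} (hd : d.Valid) : d.up.Valid := by
  obtain ⟨a, b, u, s⟩ := d
  simp only [Valid, LatticeState.up] at *
  split_ifs <;> dsimp only <;> omega

theorem LatticeState.Valid.down {d : LatticeState} (hd : d.Valid) : d.down.Valid := by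
  obtain ⟨a, b, u, s⟩ := d
  simp only [Valid, LatticeState.down] at *
  split_ifs <;> dsimp only <;> omega

theorem stepQuad_toQuad_up {h : ℝ} (hh : 0 < h) {d : LatticeState} (hd : d.Valid) :
    stepQuad (d.toQuad h) h = d.up.toQuad h := by
  obtain ⟨a, b, u, s⟩ := d
  simp only [Valid] at hd
  simp only [toQuad, LatticeState.up, stepQuad_mk]
  have e : ((u : ℝ) - a) * h + h = ((u + 1 : ℕ) - a : ℝ) * h := by push_cast; ring
  rw [e]
  by_cases hu : u < a + b
  · have h1 : ((u + 1 : ℕ) : ℝ) ≤ a + b := by exact_mod_cast hu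
    have h2 : (0 : ℝ) ≤ (u + 1 : ℕ) := by positivity
    rw [if_neg (by nlinarith), if_neg (by nlinarith), if_pos hu]
  · obtain rfl : u = a + b := by omega
    rw [if_pos (by push_cast; nlinarith), if_neg hu]
    simp only [Prod.mk.injEq, and_true, true_and]
    push_cast
    ring

theorem stepQuad_toQuad_down {h : ℝ} (hh : 0 < h) {d : LatticeState} (hd : d.Valid) :
    stepQuad (d.toQuad h) (-h) = d.down.toQuad h := by
  obtain ⟨a, b, u, s⟩ := d
  simp only [Valid] at hd
  simp only [toQuad, LatticeState.down, stepQuad_mk]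
  have h1 : (u : ℝ) ≤ a + b := by exact_mod_cast hd
  by_cases hu : 0 < u
  · obtain ⟨v, rfl⟩ : ∃ v, u = v + 1 := ⟨u - 1, by omega⟩
    have h2 : (0 : ℝ) ≤ v := by positivity
    push_cast at h1 ⊢
    rw [if_neg (by nlinarith), if_neg (by nlinarith), if_pos hu]
    simp only [Prod.mk.injEq, and_true, true_and]
    ring
  · obtain rfl : u = 0 := by omega
    have h2 : (0 : ℝ) ≤ b * h := by positivity
    have h3 : (0 : ℝ) ≤ a * h := by positivity
    have e : (((0 : ℕ) : ℝ) - a) * h + -h = -(((a + 1 : ℕ) : ℝ) * h) := by push_cast; ring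
    have e' : ((a + 1 : ℕ) : ℝ) * h = a * h + h := by push_cast; ring
    rw [e, if_neg (by rw [e']; linarith), if_pos (by rw [e']; linarith), if_neg hu]
    simp only [Prod.mk.injEq, and_true, true_and]
    push_cast
    ring

theorem toQuad_injective {h : ℝ} (hh : 0 < h) : Function.Injective (toQuad h) := by
  rintro ⟨a, b, u, s⟩ ⟨a', b', u', s'⟩ he
  simp only [toQuad, Prod.mk.injEq] at he
  obtain ⟨h1, h2, h3, h4⟩ := he
  have h1 : a = a' := by
    have : (a : ℝ) = a' := mul_right_cancel₀ hh.ne' (by linarith)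
    exact_mod_cast this
  have h3 : b = b' := by exact_mod_cast mul_right_cancel₀ hh.ne' h3
  subst h1
  have h2 := mul_right_cancel₀ hh.ne' h2
  have h2 : u = u' := by
    have : (u : ℝ) = u' := by linarith
    exact_mod_cast this
  simp [h2, h3, h4]

/-- Turns condition 1, for a law on the state space, into the form used throughout: `m` is carried
by valid lattice states. -/
theorem exists_valid_toQuad_iff {h : ℝ} (hh : 0 < h) (z : Quad) :
    (∃ d : LatticeState, d.Valid ∧ d.toQuad h = z) ↔
      z ∈ stateSpace h ∧ z.I ≤ z.X ∧ z.X ≤ z.S := by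
  constructor
  · rintro ⟨⟨a, b, u, s⟩, hd, rfl⟩
    simp only [Valid] at hd
    have h1 : (u : ℝ) ≤ a + b := by exact_mod_cast hd
    have h2 : (0 : ℝ) ≤ u := by positivity
    refine ⟨⟨⟨a, rfl⟩, ⟨u - a, ?_⟩, ⟨b, rfl⟩⟩, ?_, ?_⟩
    · simp [toQuad]
    · simp only [toQuad, Quad.I, Quad.X]; nlinarith
    · simp only [toQuad, Quad.S, Quad.X]; nlinarith
  · obtain ⟨I, X, S, s⟩ := z
    rintro ⟨⟨⟨a, ha⟩, ⟨k, hk⟩, ⟨b, hb⟩⟩, h1, h2⟩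
    simp only [Quad.I, Quad.X, Quad.S] at *
    subst ha hk hb
    have h1 : -(a : ℤ) ≤ k := by
      have : -(a : ℝ) ≤ k := le_of_mul_le_mul_right (by linarith) hh
      exact_mod_cast this
    have h2 : k ≤ b := by
      have : (k : ℝ) ≤ b := le_of_mul_le_mul_right (by linarith) hh
      exact_mod_cast this
    refine ⟨(a, b, (k + a).toNat, s), ?_, ?_⟩
    · simp only [Valid]; omega
    · have : (((k + a).toNat : ℤ) : ℝ) = ((k + a : ℤ) : ℝ) := by
        rw [Int.toNat_of_nonneg (by omega)]
      simp only [toQuad, Prod.mk.injEq, true_and, and_true]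
      rw [Int.cast_natCast] at this
      rw [this]; push_cast; ring

end StoppedWalk

namespace StoppedWalk

open LatticeState Filter Topology

/-! ### Superharmonic functions of the quadruple -/

section Walk

variable {Ω : Type*} {mΩ : MeasurableSpace Ω} {P : Measure Ω} {h : ℝ} {ℱ : Filtration ℕ mΩ}
  {ξ : ℕ → Ω → ℝ}

theorem IsSymmetricSimpleRandomWalk.measurable (hξ : IsSymmetricSimpleRandomWalk P h ℱ ξ) (n : ℕ) :
    Measurable (ξ n) := (hξ.adapted n).mono (ℱ.le n) le_rfl

theorem IsSymmetricSimpleRandomWalk.ae_increment [IsProbabilityMeasure P] (hh : 0 < h)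
    (hξ : IsSymmetricSimpleRandomWalk P h ℱ ξ) (n : ℕ) :
    ∀ᵐ ω ∂P, ξ (n + 1) ω - ξ n ω = h ∨ ξ (n + 1) ω - ξ n ω = -h := by
  have hm := (hξ.measurable (n + 1)).sub (hξ.measurable n)
  have hu : MeasurableSet {ω | ξ (n + 1) ω - ξ n ω = h} := hm (measurableSet_singleton h)
  have hd : MeasurableSet {ω | ξ (n + 1) ω - ξ n ω = -h} := hm (measurableSet_singleton (-h))
  have hdisj : Disjoint {ω | ξ (n + 1) ω - ξ n ω = h} {ω | ξ (n + 1) ω - ξ n ω = -h} := by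
    rw [Set.disjoint_left]
    intro ω h1 h2
    simp only [Set.mem_ofPred_eq] at h1 h2
    linarith
  have := measure_union (μ := P) hdisj hd
  rw [hξ.step_up, hξ.step_down, ENNReal.add_halves] at this
  exact (prob_compl_eq_zero_iff (hu.union hd)).2 this

theorem IsSymmetricSimpleRandomWalk.ae_lattice [IsProbabilityMeasure P] (hh : 0 < h)
    (hξ : IsSymmetricSimpleRandomWalk P h ℱ ξ) :
    ∀ᵐ ω ∂P, ∀ n, ∃ d : LatticeState, d.Valid ∧ d.toQuad h = quadProcess ξ n ω := by
  filter_upwards [hξ.start, ae_all_iff.2 (hξ.ae_increment hh)] with ω h0 hinc n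
  induction n with
  | zero =>
    refine ⟨origin, by simp [Valid, origin], ?_⟩
    rw [quadProcess_zero, h0]
    simp [toQuad, origin]
  | succ n ih =>
    obtain ⟨d, hd, he⟩ := ih
    rw [quadProcess_succ, ← he]
    rcases hinc n with hi | hi <;> rw [hi]
    · exact ⟨_, hd.up, (stepQuad_toQuad_up hh hd).symm⟩
    · exact ⟨_, hd.down, (stepQuad_toQuad_down hh hd).symm⟩

theorem measurable_quadProcess (hξ : Adapted ℱ ξ) (n : ℕ) :
    Measurable[ℱ n] (quadProcess ξ n) := by
  induction n with
  | zero =>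
    have : quadProcess ξ 0 = fun ω => (ξ 0 ω, ξ 0 ω, ξ 0 ω, -1) := funext (quadProcess_zero ξ)
    rw [this]
    have := hξ 0
    exact this.prodMk (this.prodMk (this.prodMk measurable_const))
  | succ n ih =>
    have e : quadProcess ξ (n + 1) =
        fun ω => stepQuad (quadProcess ξ n ω) (ξ (n + 1) ω - ξ n ω) :=
      funext (quadProcess_succ ξ n)
    rw [e]
    have h1 := ih.mono (ℱ.mono n.le_succ) le_rfl
    have h2 := (hξ n).mono (ℱ.mono n.le_succ) le_rfl
    exact measurable_stepQuad.comp (h1.prodMk ((hξ (n + 1)).sub h2))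

/-- An increment equal to `e` halves integrals of functions of the past. -/
theorem integral_indicator_increment [IsProbabilityMeasure P]
    (hξ : IsSymmetricSimpleRandomWalk P h ℱ ξ) {n : ℕ} {e : ℝ}
    (he : P {ω | ξ (n + 1) ω - ξ n ω = e} = 1 / 2) {Y : Ω → ℝ} (hY : Measurable[ℱ n] Y) :
    ∫ ω, {ω | ξ (n + 1) ω - ξ n ω = e}.indicator (fun _ => (1 : ℝ)) ω * Y ω ∂P
      = 1 / 2 * ∫ ω, Y ω ∂P := by
  have hm := (hξ.measurable (n + 1)).sub (hξ.measurable n)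
  have hs : MeasurableSet {ω | ξ (n + 1) ω - ξ n ω = e} := hm (measurableSet_singleton e)
  have hind : IndepFun ({ω | ξ (n + 1) ω - ξ n ω = e}.indicator (fun _ => (1 : ℝ))) Y P := by
    rw [IndepFun_iff_Indep]
    refine indep_of_indep_of_le_right (indep_of_indep_of_le_left (hξ.indep n) ?_) hY.comap_le
    have : {ω | ξ (n + 1) ω - ξ n ω = e}.indicator (fun _ => (1 : ℝ))
        = ({e} : Set ℝ).indicator (fun _ => (1 : ℝ)) ∘ fun ω => ξ (n + 1) ω - ξ n ω := by
      ext ω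
      by_cases hω : ξ (n + 1) ω - ξ n ω = e <;> simp [hω]
    rw [this, ← MeasurableSpace.comap_comp]
    exact MeasurableSpace.comap_mono
      (measurable_const.indicator (measurableSet_singleton e)).comap_le
  rw [hind.integral_fun_mul_eq_mul_integral
    (measurable_const.indicator hs).aestronglyMeasurable
    (hY.mono (ℱ.le n) le_rfl).aestronglyMeasurable, integral_indicator_const _ hs]
  simp [measureReal_def, he]

variable {f : Quad → ℝ} {C : ℝ}

theorem integrable_comp_of_bounded_on_lattice [IsProbabilityMeasure P] (hf : Measurable f)
    (hC : ∀ d : LatticeState, d.Valid → |f (d.toQuad h)| ≤ C) {Z : Ω → Quad} (hZ : Measurable Z)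
    (hZl : ∀ᵐ ω ∂P, ∃ d : LatticeState, d.Valid ∧ d.toQuad h = Z ω) :
    Integrable (fun ω => f (Z ω)) P := by
  refine Integrable.of_bound (hf.comp hZ).aestronglyMeasurable C ?_
  filter_upwards [hZl] with ω ⟨d, hd, he⟩
  rw [← he]
  exact hC d hd

/-- On an event of the past, the next quadruple is one of two images of the current one, selected by
an increment independent of the past. The integral is therefore the average over the two images, and
superharmonicity on the lattice applies. -/
theorem setIntegral_quadProcess_succ_le [IsProbabilityMeasure P] (hh : 0 < h)
    (hξ : IsSymmetricSimpleRandomWalk P h ℱ ξ) (hf : Measurable f)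
    (hC : ∀ d : LatticeState, d.Valid → |f (d.toQuad h)| ≤ C)
    (hsup : ∀ d : LatticeState, d.Valid →
      f (d.up.toQuad h) + f (d.down.toQuad h) ≤ 2 * f (d.toQuad h))
    (n : ℕ) {s : Set Ω} (hs : MeasurableSet[ℱ n] s) :
    ∫ ω in s, f (quadProcess ξ (n + 1) ω) ∂P ≤ ∫ ω in s, f (quadProcess ξ n ω) ∂P := by
  have hZ := measurable_quadProcess hξ.adapted
  have hZ' := fun n => (hZ n).mono (ℱ.le n) le_rfl
  have hl := hξ.ae_lattice hh
  have hs' := ℱ.le n s hs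
  have hmeas : ∀ e : ℝ, Measurable[ℱ n] fun ω => s.indicator
      (fun ω => f (stepQuad (quadProcess ξ n ω) e)) ω := fun e =>
    Measurable.indicator (hf.comp (measurable_stepQuad.comp ((hZ n).prodMk measurable_const))) hs
  have hint : ∀ e : ℝ, (e = h ∨ e = -h) → Integrable (fun ω => s.indicator
      (fun ω => f (stepQuad (quadProcess ξ n ω) e)) ω) P := by
    intro e he
    refine Integrable.indicator ?_ hs'
    refine integrable_comp_of_bounded_on_lattice hf hC
      (measurable_stepQuad.comp ((hZ' n).prodMk measurable_const)) ?_
    filter_upwards [hl] with ω hω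
    obtain ⟨d, hd, hde⟩ := hω n
    simp only [← hde]
    rcases he with rfl | rfl
    · exact ⟨_, hd.up, (stepQuad_toQuad_up hh hd).symm⟩
    · exact ⟨_, hd.down, (stepQuad_toQuad_down hh hd).symm⟩
  have hincm := (hξ.measurable (n + 1)).sub (hξ.measurable n)
  have hint' : ∀ e : ℝ, (e = h ∨ e = -h) → Integrable (fun ω =>
      {ω | ξ (n + 1) ω - ξ n ω = e}.indicator (fun _ => (1 : ℝ)) ω * s.indicator
      (fun ω => f (stepQuad (quadProcess ξ n ω) e)) ω) P := by
    intro e he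
    have hes : MeasurableSet {ω | ξ (n + 1) ω - ξ n ω = e} := hincm (measurableSet_singleton e)
    refine ((hint e he).indicator hes).congr (ae_of_all _ fun ω => ?_)
    by_cases hω : ω ∈ {ω | ξ (n + 1) ω - ξ n ω = e} <;> simp [hω]
  rw [← integral_indicator hs', ← integral_indicator hs']
  calc ∫ ω, s.indicator (fun ω => f (quadProcess ξ (n + 1) ω)) ω ∂P
      = ∫ ω, ({ω | ξ (n + 1) ω - ξ n ω = h}.indicator (fun _ => (1 : ℝ)) ω * s.indicator
          (fun ω => f (stepQuad (quadProcess ξ n ω) h)) ω +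
        {ω | ξ (n + 1) ω - ξ n ω = -h}.indicator (fun _ => (1 : ℝ)) ω * s.indicator
          (fun ω => f (stepQuad (quadProcess ξ n ω) (-h))) ω) ∂P := by
        refine integral_congr_ae ?_
        filter_upwards [hξ.ae_increment hh n] with ω hω
        have hne : h ≠ -h := by linarith
        by_cases hωs : ω ∈ s
        · rcases hω with hω | hω
          · simp [Set.indicator, hωs, quadProcess_succ, hω, hne]
          · simp [Set.indicator, hωs, quadProcess_succ, hω, hne.symm]
        · simp [hωs]
    _ = 1 / 2 * (∫ ω, s.indicator (fun ω => f (stepQuad (quadProcess ξ n ω) h)) ω ∂P) +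
        1 / 2 * (∫ ω, s.indicator (fun ω => f (stepQuad (quadProcess ξ n ω) (-h))) ω ∂P) := by
        rw [integral_add (hint' h (Or.inl rfl)) (hint' (-h) (Or.inr rfl)),
          integral_indicator_increment hξ (hξ.step_up n) (hmeas h),
          integral_indicator_increment hξ (hξ.step_down n) (hmeas (-h))]
    _ = ∫ ω, 1 / 2 * (s.indicator (fun ω => f (stepQuad (quadProcess ξ n ω) h)) ω +
        s.indicator (fun ω => f (stepQuad (quadProcess ξ n ω) (-h))) ω) ∂P := by
        rw [integral_const_mul, integral_add (hint h (Or.inl rfl)) (hint (-h) (Or.inr rfl))]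
        ring
    _ ≤ ∫ ω, s.indicator (fun ω => f (quadProcess ξ n ω)) ω ∂P := by
        refine integral_mono_ae (((hint h (Or.inl rfl)).add (hint (-h) (Or.inr rfl))).const_mul _)
          ((integrable_comp_of_bounded_on_lattice hf hC (hZ' n)
            (hl.mono fun ω hω => hω n)).indicator hs') ?_
        filter_upwards [hl] with ω hω
        obtain ⟨d, hd, he⟩ := hω n
        by_cases hωs : ω ∈ s
        · have := hsup d hd
          simp only [Set.indicator_of_mem hωs, ← he, stepQuad_toQuad_up hh hd,
            stepQuad_toQuad_down hh hd]
          linarith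
        · simp [hωs]

theorem measurable_stoppedQuad (hξ : IsSymmetricSimpleRandomWalk P h ℱ ξ) {T : Ω → WithTop ℕ}
    (hT : IsStoppingTime ℱ T) : Measurable (stoppedValue (quadProcess ξ) T) := by
  have hTm : Measurable fun ω => (T ω).untopA :=
    WithTop.measurable_untopA.comp hT.measurable'
  refine measurable_from_prod_countable_right (f := fun p : ℕ × Ω => quadProcess ξ p.1 p.2)
    ?_ |>.comp (hTm.prodMk measurable_id)
  intro n
  exact (measurable_quadProcess hξ.adapted n).mono (ℱ.le n) le_rfl

/-- Superharmonic functions decrease in mean along the stopped walk. -/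
theorem integral_stoppedQuad_le [IsProbabilityMeasure P] (hh : 0 < h)
    (hξ : IsSymmetricSimpleRandomWalk P h ℱ ξ) {T : Ω → WithTop ℕ}
    (hT : IsStoppingTime ℱ T) (hTfin : ∀ᵐ ω ∂P, T ω ≠ ⊤) (hf : Measurable f)
    (hC : ∀ d : LatticeState, d.Valid → |f (d.toQuad h)| ≤ C)
    (hsup : ∀ d : LatticeState, d.Valid →
      f (d.up.toQuad h) + f (d.down.toQuad h) ≤ 2 * f (d.toQuad h)) :
    ∫ ω, f (stoppedValue (quadProcess ξ) T ω) ∂P ≤ f (origin.toQuad h) := by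
  have hZ := measurable_quadProcess hξ.adapted
  have hl := hξ.ae_lattice hh
  have hint : ∀ n, Integrable (fun ω => f (quadProcess ξ n ω)) P := fun n =>
    integrable_comp_of_bounded_on_lattice hf hC ((hZ n).mono (ℱ.le n) le_rfl)
      (hl.mono fun ω hω => hω n)
  have hsub : Submartingale (fun n ω => -f (quadProcess ξ n ω)) ℱ P := by
    refine submartingale_of_setIntegral_le_succ
      (fun n => ((hf.comp (hZ n)).neg).stronglyMeasurable) (fun n => (hint n).neg) ?_
    intro n s hs
    rw [integral_neg, integral_neg]
    exact neg_le_neg (setIntegral_quadProcess_succ_le hh hξ hf hC hsup n hs)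
  have hbd : ∀ n : ℕ, ∫ ω, f (stoppedValue (quadProcess ξ) (fun ω => min (T ω) n) ω) ∂P ≤
      f (origin.toQuad h) := by
    intro n
    have h1 := hsub.expected_stoppedValue_mono (isStoppingTime_const ℱ 0)
      (hT.min (isStoppingTime_const ℱ n)) (fun ω => by exact bot_le) (N := n)
      (fun ω => min_le_right _ _)
    have h0 : ∫ ω, f (quadProcess ξ 0 ω) ∂P = f (origin.toQuad h) := by
      rw [integral_congr_ae (g := fun _ => f (origin.toQuad h)), integral_const]
      · simp
      · filter_upwards [hξ.start] with ω hω
        rw [quadProcess_zero, hω]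
        simp [toQuad, origin]
    have h2 : ∫ ω, -f (quadProcess ξ 0 ω) ∂P ≤
      ∫ ω, -f (stoppedValue (quadProcess ξ) (fun ω => min (T ω) n) ω) ∂P := h1
    rw [integral_neg, integral_neg, h0] at h2
    linarith
  -- The bound at `min T n` passes to the limit by dominated convergence: almost every path has its
  -- stopped value eventually constant in `n`, and `|f| ≤ C` on the lattice.
  refine le_of_tendsto (f := fun n : ℕ =>
    ∫ ω, f (stoppedValue (quadProcess ξ) (fun ω => min (T ω) n) ω) ∂P) (x := atTop) ?_
    (Eventually.of_forall hbd)
  refine tendsto_integral_of_dominated_convergence (fun _ => C) (fun n => ?_)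
    (integrable_const C) (fun n => ?_) ?_
  · exact (hf.comp (measurable_stoppedQuad hξ
      (hT.min (isStoppingTime_const ℱ n)))).aestronglyMeasurable
  · filter_upwards [hl] with ω hω
    obtain ⟨d, hd, he⟩ := hω (min (T ω) n).untopA
    simp only [stoppedValue]
    rw [← he]
    exact hC d hd
  · filter_upwards [hTfin] with ω hω
    obtain ⟨t, ht⟩ := WithTop.ne_top_iff_exists.1 hω
    refine tendsto_const_nhds.congr' ?_
    filter_upwards [eventually_ge_atTop t] with n hn
    have : min (T ω) (n : WithTop ℕ) = T ω := by
      rw [← ht]; exact min_eq_left (WithTop.coe_le_coe.2 hn)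
    simp only [stoppedValue, this]

end Walk

end StoppedWalk

namespace StoppedWalk

open LatticeState Filter Topology

/-! ### Test functions attached to windows and cells -/

/-- The event `S < b, I > -a`. -/
def window (a b : ℝ) : Set Quad := {z | z.S < b ∧ -a < z.I}

theorem measurableSet_window (a b : ℝ) : MeasurableSet (window a b) := by
  have h1 : MeasurableSet {z : Quad | z.2.2.1 < b} := measurableSet_lt (by fun_prop) (by fun_prop)
  have h2 : MeasurableSet {z : Quad | -a < z.1} := measurableSet_lt (by fun_prop) (by fun_prop)
  exact h1.inter h2

instance : MeasurableSingletonClass ℤˣ where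
  measurableSet_singleton s := by
    have h1 := comap_measurable (Units.val : ℤˣ → ℤ) (measurableSet_singleton (s : ℤ))
    have h2 : ({s} : Set ℤˣ) = Units.val ⁻¹' {(s : ℤ)} := by
      ext z
      simp [Units.val_inj]
    rw [h2]
    exact h1

theorem measurableSet_cell (a b : ℝ) (s : ℤˣ) : MeasurableSet (cell a b s) := by
  unfold cell Quad.S Quad.I Quad.sig
  have hs : MeasurableSet {z : Quad | z.2.2.2 = s} := by
    have h1 : Measurable fun z : Quad => z.2.2.2 := by fun_prop
    exact h1 (measurableSet_singleton s)
  exact (measurableSet_eq_fun (by fun_prop) (by fun_prop)).inter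
    ((measurableSet_eq_fun (by fun_prop) (by fun_prop)).inter hs)

theorem toQuad_mem_window {h : ℝ} (hh : 0 < h) (i j : ℕ) (d : LatticeState) :
    d.toQuad h ∈ window (i * h) (j * h) ↔ d.2.1 < j ∧ d.1 < i := by
  simp only [window, toQuad, Quad.S, Quad.I, Set.mem_ofPred_eq, neg_lt_neg_iff,
    mul_lt_mul_iff_left₀ hh, Nat.cast_lt]

theorem toQuad_mem_cell {h : ℝ} (hh : 0 < h) (i j : ℕ) (s : ℤˣ) (d : LatticeState) :
    d.toQuad h ∈ cell (i * h) (j * h) s ↔ d.2.1 = j ∧ d.1 = i ∧ d.2.2.2 = s := by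
  simp only [cell, toQuad, Quad.S, Quad.I, Quad.sig, Set.mem_ofPred_eq, neg_inj,
    mul_left_inj' hh.ne', Nat.cast_inj]

/-- In the window the function is affine in the position and vanishes at level `-i`, so leaving
through the bottom causes no defect. Leaving through level `j` replaces the affine value `i + j` by
`0`, which is the only defect. -/
theorem windowUp_laplacian (i j : ℕ) (w : LatticeState → ℝ)
    (hw : ∀ d, w d = if d.2.1 < j ∧ d.1 < i then (i + d.2.2.1 - d.1 : ℝ) else 0)
    (d : LatticeState) (hd : d.Valid) :
    w d.up + w d.down - 2 * w d =
      if d.2.1 + 1 = j ∧ d.1 < i ∧ d.2.2.1 = d.1 + d.2.1 then -(i + j : ℝ) else 0 := by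
  obtain ⟨α, β, u, s⟩ := d
  simp only [Valid] at hd
  simp only [LatticeState.up, LatticeState.down]
  by_cases hin : β < j ∧ α < i
  · obtain ⟨h1, h2⟩ := hin
    have e0 : w (α, β, u, s) = i + u - α := by rw [hw, if_pos ⟨h1, h2⟩]
    have e1 : w (if 0 < u then (α, β, u - 1, s) else (α + 1, β, 0, -1)) = i + u - α - 1 := by
      split_ifs with hu
      · rw [hw, if_pos ⟨h1, h2⟩]
        push_cast [Nat.cast_sub hu]
        ring
      · obtain rfl : u = 0 := by omega
        rw [hw]
        split_ifs with hc
        · push_cast; ring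
        · dsimp only at hc
          obtain rfl : i = α + 1 := by omega
          push_cast; ring
    rw [e0, e1]
    by_cases hu : u < α + β
    · rw [if_pos hu, hw, if_pos ⟨h1, h2⟩, if_neg (by omega)]
      push_cast; ring
    · obtain rfl : u = α + β := by omega
      rw [if_neg hu, hw]
      by_cases hj : β + 1 = j
      · subst hj
        rw [if_neg (by simp), if_pos (by simpa using h2)]
        push_cast; ring
      · rw [if_pos (by dsimp only; omega), if_neg (by omega)]
        push_cast; ring
  · have e0 : w (α, β, u, s) = 0 := by rw [hw, if_neg hin]
    have e1 : w (if u < α + β then (α, β, u + 1, s) else (α, β + 1, u + 1, 1)) = 0 := by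
      split_ifs
      · rw [hw, if_neg hin]
      · rw [hw, if_neg (by dsimp only; omega)]
    have e2 : w (if 0 < u then (α, β, u - 1, s) else (α + 1, β, 0, -1)) = 0 := by
      split_ifs
      · rw [hw, if_neg hin]
      · rw [hw, if_neg (by dsimp only; omega)]
    rw [e0, e1, e2, if_neg (by omega)]
    ring

theorem windowDown_laplacian (i j : ℕ) (w : LatticeState → ℝ)
    (hw : ∀ d, w d = if d.2.1 < j ∧ d.1 < i then (j - d.2.2.1 + d.1 : ℝ) else 0)
    (d : LatticeState) (hd : d.Valid) :
    w d.up + w d.down - 2 * w d =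
      if d.2.1 < j ∧ d.1 + 1 = i ∧ d.2.2.1 = 0 then -(i + j : ℝ) else 0 := by
  obtain ⟨α, β, u, s⟩ := d
  simp only [Valid] at hd
  simp only [LatticeState.up, LatticeState.down]
  by_cases hin : β < j ∧ α < i
  · obtain ⟨h1, h2⟩ := hin
    have e0 : w (α, β, u, s) = j - u + α := by rw [hw, if_pos ⟨h1, h2⟩]
    have e1 : w (if u < α + β then (α, β, u + 1, s) else (α, β + 1, u + 1, 1))
        = j - u + α - 1 := by
      split_ifs with hu
      · rw [hw, if_pos ⟨h1, h2⟩]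
        push_cast
        ring
      · obtain rfl : u = α + β := by omega
        rw [hw]
        split_ifs with hc
        · push_cast; ring
        · dsimp only at hc
          obtain rfl : j = β + 1 := by omega
          push_cast; ring
    rw [e0, e1]
    by_cases hu : 0 < u
    · rw [if_pos hu, hw, if_pos ⟨h1, h2⟩, if_neg (by omega)]
      push_cast [Nat.cast_sub hu]; ring
    · obtain rfl : u = 0 := by omega
      rw [if_neg hu, hw]
      by_cases hi : α + 1 = i
      · subst hi
        rw [if_neg (by simp), if_pos (by simpa using h1)]
        push_cast; ring
      · rw [if_pos (by dsimp only; omega), if_neg (by omega)]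
        push_cast; ring
  · have e0 : w (α, β, u, s) = 0 := by rw [hw, if_neg hin]
    have e1 : w (if u < α + β then (α, β, u + 1, s) else (α, β + 1, u + 1, 1)) = 0 := by
      split_ifs
      · rw [hw, if_neg hin]
      · rw [hw, if_neg (by dsimp only; omega)]
    have e2 : w (if 0 < u then (α, β, u - 1, s) else (α + 1, β, 0, -1)) = 0 := by
      split_ifs
      · rw [hw, if_neg hin]
      · rw [hw, if_neg (by dsimp only; omega)]
    rw [e0, e1, e2, if_neg (by omega)]
    ring

/-- In the cell the function is affine and vanishes one step above the top, so an upward exit is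
exact. A downward exit replaces the extrapolated value `i + j + 2` by `0` and only lowers the sum. A
positive Laplacian arises only where an upward step enters the cell, at its top, where the function
equals `1`. -/
theorem cellPlus_laplacian_le (i j : ℕ) (c : LatticeState → ℝ)
    (hc : ∀ d, c d = if d.2.1 = j ∧ d.1 = i ∧ d.2.2.2 = 1 then (j + 1 - d.2.2.1 + d.1 : ℝ) else 0)
    (d : LatticeState) (hd : d.Valid) :
    c d.up + c d.down - 2 * c d ≤
      if d.2.1 + 1 = j ∧ d.1 = i ∧ d.2.2.1 = d.1 + d.2.1 then 1 else 0 := by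
  obtain ⟨α, β, u, s⟩ := d
  have hs : (-1 : ℤˣ) ≠ 1 := by decide
  simp only [Valid] at hd
  simp only [LatticeState.up, LatticeState.down]
  by_cases hin : β = j ∧ α = i ∧ s = 1
  · have hin' := hin
    obtain ⟨rfl, rfl, rfl⟩ := hin'
    have hdR : (u : ℝ) ≤ α + β := by exact_mod_cast hd
    have e0 : c (α, β, u, 1) = β + 1 - u + α := by rw [hc, if_pos hin]
    have e1 : c (if u < α + β then (α, β, u + 1, 1) else (α, β + 1, u + 1, 1))
        = β - u + α := by
      split_ifs with hu
      · rw [hc, if_pos hin]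
        push_cast; ring
      · obtain rfl : u = α + β := by omega
        rw [hc, if_neg (by simp)]
        push_cast; ring
    have e2 : c (if 0 < u then (α, β, u - 1, 1) else (α + 1, β, 0, -1)) ≤ β + 2 - u + α := by
      split_ifs with hu
      · rw [hc, if_pos hin]
        push_cast [Nat.cast_sub hu]
        linarith
      · rw [hc, if_neg (by simp)]
        linarith
    have hne : ¬(β + 1 = β ∧ α = α ∧ u = α + β) := by omega
    rw [e0, e1, if_neg hne]
    linarith
  · have e0 : c (α, β, u, s) = 0 := by rw [hc, if_neg hin]
    have e2 : c (if 0 < u then (α, β, u - 1, s) else (α + 1, β, 0, -1)) = 0 := by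
      split_ifs
      · rw [hc, if_neg hin]
      · rw [hc, if_neg (by simp [hs])]
    rw [e0, e2]
    by_cases hu : u < α + β
    · rw [if_pos hu, hc, if_neg hin, if_neg (by omega)]
      simp
    · obtain rfl : u = α + β := by omega
      rw [if_neg hu, hc]
      by_cases hj : β + 1 = j ∧ α = i
      · rw [if_pos ⟨hj.1, hj.2, rfl⟩, if_pos ⟨hj.1, hj.2, rfl⟩]
        obtain ⟨rfl, rfl⟩ := hj
        push_cast; linarith
      · rw [if_neg (fun hx => hj ⟨hx.1, hx.2.1⟩), if_neg (fun hx => hj ⟨hx.1, hx.2.1⟩)]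
        simp

/-- Mirror image of `cellPlus_laplacian_le`: the function vanishes one step below the bottom and
equals `1` at the entry level `u = 0`. -/
theorem cellMinus_laplacian_le (i j : ℕ) (c : LatticeState → ℝ)
    (hc : ∀ d, c d =
      if d.2.1 = j ∧ d.1 = i ∧ d.2.2.2 = -1 then (i + 1 + d.2.2.1 - d.1 : ℝ) else 0)
    (d : LatticeState) (hd : d.Valid) :
    c d.up + c d.down - 2 * c d ≤
      if d.2.1 = j ∧ d.1 + 1 = i ∧ d.2.2.1 = 0 then 1 else 0 := by
  obtain ⟨α, β, u, s⟩ := d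
  have hs : (1 : ℤˣ) ≠ -1 := by decide
  simp only [Valid] at hd
  simp only [LatticeState.up, LatticeState.down]
  by_cases hin : β = j ∧ α = i ∧ s = -1
  · have hin' := hin
    obtain ⟨rfl, rfl, rfl⟩ := hin'
    have hdR : (0 : ℝ) ≤ u := by positivity
    have e0 : c (α, β, u, -1) = 1 + u := by rw [hc, if_pos hin]; push_cast; ring
    have e1 : c (if u < α + β then (α, β, u + 1, -1) else (α, β + 1, u + 1, 1)) ≤ 2 + u := by
      split_ifs with hu
      · rw [hc, if_pos hin]
        push_cast; linarith
      · rw [hc, if_neg (by simp)]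
        linarith
    have e2 : c (if 0 < u then (α, β, u - 1, -1) else (α + 1, β, 0, -1)) = u := by
      split_ifs with hu
      · rw [hc, if_pos hin]
        push_cast [Nat.cast_sub hu]
        ring
      · obtain rfl : u = 0 := by omega
        rw [hc, if_neg (by simp)]
        simp
    have hne : ¬(β = β ∧ α + 1 = α ∧ u = 0) := by omega
    rw [e0, e2, if_neg hne]
    linarith
  · have e0 : c (α, β, u, s) = 0 := by rw [hc, if_neg hin]
    have e2 : c (if u < α + β then (α, β, u + 1, s) else (α, β + 1, u + 1, 1)) = 0 := by
      split_ifs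
      · rw [hc, if_neg hin]
      · rw [hc, if_neg (by simp [hs])]
    rw [e0, e2]
    by_cases hu : 0 < u
    · rw [if_pos hu, hc, if_neg hin, if_neg (by omega)]
      simp
    · obtain rfl : u = 0 := by omega
      rw [if_neg hu, hc]
      by_cases hj : β = j ∧ α + 1 = i
      · rw [if_pos ⟨hj.1, hj.2, rfl⟩, if_pos ⟨hj.1, hj.2, rfl⟩]
        obtain ⟨rfl, rfl⟩ := hj
        push_cast; linarith
      · rw [if_neg (fun hx => hj ⟨hx.1, hx.2.1⟩), if_neg (fun hx => hj ⟨hx.1, hx.2.1⟩)]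
        simp

/-! ### The conditions in cross-multiplied form -/

/-- For `p < 0` the ratio inequality is automatic, so cross-multiplication is legitimate only
together with `0 ≤ p`. Conversely the cross-multiplied form forces `0 ≤ p`, because its left side is
nonnegative. -/
theorem ratioLE_and_nonneg_iff {x p h d : ℝ} (hx : 0 ≤ x) (hh : 0 < h) (hd : 0 < d) :
    RatioLE x p h d ∧ 0 ≤ p ↔ x * d ≤ h * p := by
  constructor
  · rintro ⟨⟨h1, h2⟩, hp⟩
    rcases hp.eq_or_lt with hp | hp
    · exact h2 hp.symm
    · exact (div_le_div_iff₀ hp hd).1 (h1 hp.ne')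
  · intro hle
    have hp : 0 ≤ p := by
      by_contra hneg
      have := mul_nonneg hx hd.le
      nlinarith
    refine ⟨⟨fun hne => ?_, fun _ => hle⟩, hp⟩
    exact (div_le_div_iff₀ (hp.lt_of_ne hne.symm) hd).2 hle

section Conditions

variable {h : ℝ} {m : Measure Quad} [IsProbabilityMeasure m]

theorem integrableOn_of_bounded_on_lattice
    (hm : ∀ᵐ z ∂m, ∃ d : LatticeState, d.Valid ∧ d.toQuad h = z) {f : Quad → ℝ}
    (hf : Measurable f) {s : Set Quad} (hs : MeasurableSet s) {C : ℝ}
    (hC : ∀ d : LatticeState, d.Valid → d.toQuad h ∈ s → |f (d.toQuad h)| ≤ C) :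
    IntegrableOn f s m := by
  refine Measure.integrableOn_of_bounded (M := C) (by simp) hf.aestronglyMeasurable ?_
  filter_upwards [ae_restrict_of_ae hm, ae_restrict_mem hs] with z ⟨d, hd, he⟩ hz
  subst he
  exact hC d hd hz

theorem measurable_X : Measurable Quad.X := by unfold Quad.X; fun_prop

theorem abs_toQuad_X_le (hh : 0 < h) {d : LatticeState} (hd : d.Valid) {i j : ℕ}
    (hi : d.1 ≤ i) (hj : d.2.1 ≤ j) : |(d.toQuad h).X| ≤ (i + j) * h := by
  obtain ⟨a, b, u, s⟩ := d
  simp only [Valid] at hd hi hj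
  simp only [toQuad, Quad.X, abs_mul, abs_of_pos hh]
  refine mul_le_mul_of_nonneg_right ?_ hh.le
  have h1 : (u : ℝ) ≤ a + b := by exact_mod_cast hd
  have h2 : (0 : ℝ) ≤ u := by positivity
  have h3 : (a : ℝ) ≤ i := by exact_mod_cast hi
  have h4 : (b : ℝ) ≤ j := by exact_mod_cast hj
  have h5 : (0 : ℝ) ≤ a := by positivity
  have h6 : (0 : ℝ) ≤ b := by positivity
  rw [abs_le]
  constructor <;> linarith

theorem integrableOn_X_cell (hh : 0 < h)
    (hm : ∀ᵐ z ∂m, ∃ d : LatticeState, d.Valid ∧ d.toQuad h = z) (i j : ℕ) (s : ℤˣ) :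
    IntegrableOn Quad.X (cell (i * h) (j * h) s) m := by
  refine integrableOn_of_bounded_on_lattice hm measurable_X (measurableSet_cell _ _ _)
    (C := (i + j) * h) fun d hd hmem => ?_
  rw [toQuad_mem_cell hh] at hmem
  exact abs_toQuad_X_le hh hd hmem.2.1.le hmem.1.le

theorem integrableOn_X_window (hh : 0 < h)
    (hm : ∀ᵐ z ∂m, ∃ d : LatticeState, d.Valid ∧ d.toQuad h = z) (i j : ℕ) :
    IntegrableOn Quad.X (window (i * h) (j * h)) m := by
  refine integrableOn_of_bounded_on_lattice hm measurable_X (measurableSet_window _ _)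
    (C := (i + j) * h) fun d hd hmem => ?_
  rw [toQuad_mem_window hh] at hmem
  exact abs_toQuad_X_le hh hd hmem.2.le hmem.1.le

theorem pZero_mul_condMean {a b : ℝ} {s : ℤˣ} :
    pZero m a b s * condMean m a b s = ∫ z in cell a b s, z.X ∂m := by
  unfold condMean
  by_cases hp : pZero m a b s = 0
  · have : m (cell a b s) = 0 := (measureReal_eq_zero_iff).1 hp
    rw [hp, setIntegral_measure_zero _ this]
    simp
  · field_simp

/-- Dividing by the mass of the cell gives `v₊ ≤ b` and `-a ≤ v₋`, so the denominators `b + h - v₊`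
and `a + h + v₋` are positive. -/
theorem integral_cell_bounds (hh : 0 < h)
    (hm : ∀ᵐ z ∂m, ∃ d : LatticeState, d.Valid ∧ d.toQuad h = z) (i j : ℕ) (s : ℤˣ) :
    ∫ z in cell (i * h) (j * h) s, z.X ∂m ≤ j * h * pZero m (i * h) (j * h) s ∧
    -(i * h) * pZero m (i * h) (j * h) s ≤ ∫ z in cell (i * h) (j * h) s, z.X ∂m := by
  have hb : ∀ᵐ z ∂m, z.I ≤ z.X ∧ z.X ≤ z.S := by
    filter_upwards [hm] with z hz
    exact ((exists_valid_toQuad_iff hh z).1 hz).2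
  have hc : ∀ c : ℝ, ∫ _ in cell (i * h) (j * h) s, c ∂m = c * pZero m (i * h) (j * h) s := by
    intro c
    rw [setIntegral_const, smul_eq_mul, mul_comm]
    rfl
  rw [← hc, ← hc]
  have hX := integrableOn_X_cell hh hm i j s
  constructor
  · refine integral_mono_ae hX (integrable_const _) ?_
    filter_upwards [ae_restrict_of_ae hb, ae_restrict_mem (measurableSet_cell _ _ _)] with z h1 h2
    exact h1.2.trans_eq h2.1
  · refine integral_mono_ae (integrable_const _) hX ?_
    filter_upwards [ae_restrict_of_ae hb, ae_restrict_mem (measurableSet_cell _ _ _)] with z h1 h2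
    exact h2.2.1.symm.trans_le h1.1

theorem setIntegral_const_add_X (a : ℝ) {s : Set Quad} (hs : IntegrableOn Quad.X s m) :
    ∫ z in s, (a + z.X) ∂m = a * m.real s + ∫ z in s, z.X ∂m := by
  rw [integral_add (integrable_const _) hs, setIntegral_const, smul_eq_mul, mul_comm]

theorem setIntegral_const_sub_X (a : ℝ) {s : Set Quad} (hs : IntegrableOn Quad.X s m) :
    ∫ z in s, (a - z.X) ∂m = a * m.real s - ∫ z in s, z.X ∂m := by
  rw [integral_sub (integrable_const _) hs, setIntegral_const, smul_eq_mul, mul_comm]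

/-- The integral inequality on the right is what the superharmonic bound yields, and also what says
that the exit flux of the cell is nonnegative. Both directions of the theorem pass through it. -/
theorem condPlus_and_nonneg_iff (hh : 0 < h)
    (hm : ∀ᵐ z ∂m, ∃ d : LatticeState, d.Valid ∧ d.toQuad h = z) (i j : ℕ) :
    CondPlus h m (i * h) (j * h) ∧ 0 ≤ psiPlus h m (i * h) (j * h) ↔
      ∫ z in cell (i * h) (j * h) 1, (j * h + h - z.X) ∂m ≤ h * psiPlus h m (i * h) (j * h) := by
  have hX := integrableOn_X_cell hh hm i j 1
  have hb := (integral_cell_bounds hh hm i j 1).1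
  have hp : 0 ≤ pZero m (i * h) (j * h) 1 := measureReal_nonneg
  have hd : 0 < j * h + h - condMean m (i * h) (j * h) 1 := by
    have hj : (0 : ℝ) ≤ j * h := by positivity
    rcases hp.eq_or_lt with hp | hp
    · rw [condMean, ← hp]; simp; positivity
    · rw [← pZero_mul_condMean, mul_comm] at hb
      have := le_of_mul_le_mul_right hb hp
      linarith
  unfold CondPlus
  rw [ratioLE_and_nonneg_iff hp hh hd, setIntegral_const_sub_X _ hX, ← pZero_mul_condMean, mul_sub]
  rw [mul_comm (j * h + h : ℝ)]
  rfl

theorem condMinus_and_nonneg_iff (hh : 0 < h)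
    (hm : ∀ᵐ z ∂m, ∃ d : LatticeState, d.Valid ∧ d.toQuad h = z) (i j : ℕ) :
    CondMinus h m (i * h) (j * h) ∧ 0 ≤ psiMinus h m (i * h) (j * h) ↔
      ∫ z in cell (i * h) (j * h) (-1), (i * h + h + z.X) ∂m ≤
        h * psiMinus h m (i * h) (j * h) := by
  have hX := integrableOn_X_cell hh hm i j (-1)
  have hb := (integral_cell_bounds hh hm i j (-1)).2
  have hp : 0 ≤ pZero m (i * h) (j * h) (-1) := measureReal_nonneg
  have hd : 0 < i * h + h + condMean m (i * h) (j * h) (-1) := by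
    have hj : (0 : ℝ) ≤ i * h := by positivity
    rcases hp.eq_or_lt with hp | hp
    · rw [condMean, ← hp]; simp; positivity
    · rw [← pZero_mul_condMean, mul_comm] at hb
      have := le_of_mul_le_mul_left hb hp
      linarith
  unfold CondMinus
  rw [ratioLE_and_nonneg_iff hp hh hd, setIntegral_const_add_X _ hX, ← pZero_mul_condMean, mul_add]
  rw [mul_comm (i * h + h : ℝ)]
  rfl

end Conditions

end StoppedWalk

namespace StoppedWalk

open LatticeState Filter Topology

/-! ### Necessity of the conditions -/

section Necessity

variable {h : ℝ} {m : Measure Quad}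

theorem phiUp_eq (a b : ℝ) :
    phiUp m a b = (a - ∫ z in window a b, (a + z.X) ∂m) / (a + b) := rfl

theorem phiDown_eq (a b : ℝ) :
    phiDown m a b = (b - ∫ z in window a b, (b - z.X) ∂m) / (a + b) := rfl

theorem psiPlus_eq (i j : ℕ) : psiPlus h m (i * h) (j * h) =
    phiUp m ((i + 1 : ℕ) * h) (j * h) - phiUp m (i * h) (j * h) := by
  unfold psiPlus; push_cast; rw [add_mul, one_mul]

theorem psiMinus_eq (i j : ℕ) : psiMinus h m (i * h) (j * h) =
    phiDown m (i * h) ((j + 1 : ℕ) * h) - phiDown m (i * h) (j * h) := by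
  unfold psiMinus; push_cast; rw [add_mul, one_mul]

theorem finite_valid_le (i j : ℕ) : {d : LatticeState | d.Valid ∧ d.1 ≤ i ∧ d.2.1 ≤ j}.Finite := by
  refine (Finset.finite_toSet (Finset.Iic i ×ˢ Finset.Iic j ×ˢ Finset.Iic (i + j) ×ˢ
    (Finset.univ : Finset ℤˣ))).subset ?_
  rintro ⟨a, b, u, s⟩ ⟨h1, h2, h3⟩
  simp only [Valid] at h1 h2 h3
  simp only [Finset.coe_product, Set.mem_prod, Finset.coe_Iic, Set.mem_Iic, Finset.coe_univ,
    Set.mem_univ, and_true]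
  omega

theorem exists_bound_of_support (f : LatticeState → ℝ) (i j : ℕ)
    (hf : ∀ d, ¬(d.1 ≤ i ∧ d.2.1 ≤ j) → f d = 0) : ∃ C, ∀ d : LatticeState, d.Valid → |f d| ≤ C := by
  obtain ⟨C, hC⟩ := ((finite_valid_le i j).image fun d => |f d|).bddAbove
  refine ⟨max C 0, fun d hd => ?_⟩
  by_cases hdd : d.1 ≤ i ∧ d.2.1 ≤ j
  · exact le_max_of_le_left (hC ⟨d, ⟨hd, hdd⟩, rfl⟩)
  · rw [hf d hdd, abs_zero]
    exact le_max_right _ _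

/-- The law `m` integrates superharmonic functions to at most their initial value. -/
def IsSuperharmonicallyDominated (h : ℝ) (m : Measure Quad) : Prop :=
  ∀ f : Quad → ℝ, Measurable f → (∃ C, ∀ d : LatticeState, d.Valid → |f (d.toQuad h)| ≤ C) →
    (∀ d : LatticeState, d.Valid →
      f (d.up.toQuad h) + f (d.down.toQuad h) ≤ 2 * f (d.toQuad h)) →
    ∫ z, f z ∂m ≤ f (origin.toQuad h)

theorem integrable_indicator_const_add_X [IsFiniteMeasure m] (a : ℝ) {s : Set Quad}
    (hs : MeasurableSet s) (hX : IntegrableOn Quad.X s m) :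
    Integrable (s.indicator fun z => a + z.X) m := by
  have : IntegrableOn (fun z : Quad => a + z.X) s m :=
    (integrable_const (μ := m.restrict s) a).add hX
  exact this.integrable_indicator hs

theorem integrable_indicator_const_sub_X [IsFiniteMeasure m] (a : ℝ) {s : Set Quad}
    (hs : MeasurableSet s) (hX : IntegrableOn Quad.X s m) :
    Integrable (s.indicator fun z => a - z.X) m := by
  have : IntegrableOn (fun z : Quad => a - z.X) s m :=
    (integrable_const (μ := m.restrict s) a).sub hX
  exact this.integrable_indicator hs

theorem toQuad_X (d : LatticeState) : (d.toQuad h).X = (d.2.2.1 - d.1 : ℝ) * h := rfl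

theorem indicator_cell_toQuad (hh : 0 < h) (i j : ℕ) (s : ℤˣ) (f : Quad → ℝ) (d : LatticeState) :
    (cell (i * h) (j * h) s).indicator f (d.toQuad h) =
      if d.2.1 = j ∧ d.1 = i ∧ d.2.2.2 = s then f (d.toQuad h) else 0 := by
  by_cases hd : d.2.1 = j ∧ d.1 = i ∧ d.2.2.2 = s
  · rw [if_pos hd, Set.indicator_of_mem ((toQuad_mem_cell hh i j s d).2 hd)]
  · rw [if_neg hd, Set.indicator_of_notMem fun hx => hd ((toQuad_mem_cell hh i j s d).1 hx)]

theorem indicator_window_toQuad (hh : 0 < h) (i j : ℕ) (f : Quad → ℝ) (d : LatticeState) :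
    (window (i * h) (j * h)).indicator f (d.toQuad h) =
      if d.2.1 < j ∧ d.1 < i then f (d.toQuad h) else 0 := by
  by_cases hd : d.2.1 < j ∧ d.1 < i
  · rw [if_pos hd, Set.indicator_of_mem ((toQuad_mem_window hh i j d).2 hd)]
  · rw [if_neg hd, Set.indicator_of_notMem fun hx => hd ((toQuad_mem_window hh i j d).1 hx)]

theorem indicator_windowUp_toQuad (hh : 0 < h) (i j : ℕ) (d : LatticeState) :
    (window (i * h) (j * h)).indicator (fun z => i * h + z.X) (d.toQuad h) =
      h * if d.2.1 < j ∧ d.1 < i then (i + d.2.2.1 - d.1 : ℝ) else 0 := by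
  rw [indicator_window_toQuad hh, mul_ite, mul_zero, toQuad_X]
  congr 1
  ring

theorem indicator_windowDown_toQuad (hh : 0 < h) (i j : ℕ) (d : LatticeState) :
    (window (i * h) (j * h)).indicator (fun z => j * h - z.X) (d.toQuad h) =
      h * if d.2.1 < j ∧ d.1 < i then (j - d.2.2.1 + d.1 : ℝ) else 0 := by
  rw [indicator_window_toQuad hh, mul_ite, mul_zero, toQuad_X]
  congr 1
  ring

theorem indicator_cellPlus_toQuad (hh : 0 < h) (i j : ℕ) (d : LatticeState) :
    (cell (i * h) (j * h) 1).indicator (fun z => j * h + h - z.X) (d.toQuad h) =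
      h * if d.2.1 = j ∧ d.1 = i ∧ d.2.2.2 = 1 then (j + 1 - d.2.2.1 + d.1 : ℝ) else 0 := by
  rw [indicator_cell_toQuad hh, mul_ite, mul_zero, toQuad_X]
  congr 1
  ring

theorem indicator_cellMinus_toQuad (hh : 0 < h) (i j : ℕ) (d : LatticeState) :
    (cell (i * h) (j * h) (-1)).indicator (fun z => i * h + h + z.X) (d.toQuad h) =
      h * if d.2.1 = j ∧ d.1 = i ∧ d.2.2.2 = -1 then (i + 1 + d.2.2.1 - d.1 : ℝ) else 0 := by
  rw [indicator_cell_toQuad hh, mul_ite, mul_zero, toQuad_X]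
  congr 1
  ring

/-- A function on a cell whose Laplacian is compensated by two window functions. -/
theorem integral_cell_add_windows_le (hh : 0 < h) (hdom : IsSuperharmonicallyDominated h m)
    {C W₁ W₀ : Quad → ℝ} (hCm : Measurable C) (hW₁m : Measurable W₁) (hW₀m : Measurable W₀)
    (hCi : Integrable C m) (hW₁i : Integrable W₁ m) (hW₀i : Integrable W₀ m)
    {c w₁ w₀ e e₁ e₀ : LatticeState → ℝ} (hC : ∀ d, C (d.toQuad h) = h * c d)
    (hW₁ : ∀ d, W₁ (d.toQuad h) = h * w₁ d) (hW₀ : ∀ d, W₀ (d.toQuad h) = h * w₀ d)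
    {k l : ℝ} (hk : 0 < k) (hl : 0 < l)
    (hc : ∀ d : LatticeState, d.Valid → c d.up + c d.down - 2 * c d ≤ e d)
    (hw₁ : ∀ d : LatticeState, d.Valid → w₁ d.up + w₁ d.down - 2 * w₁ d = -k * e₁ d)
    (hw₀ : ∀ d : LatticeState, d.Valid → w₀ d.up + w₀ d.down - 2 * w₀ d = -l * e₀ d)
    (he : ∀ d, e d = e₁ d - e₀ d) {i j : ℕ}
    (hsupp : ∀ d : LatticeState, ¬(d.1 ≤ i ∧ d.2.1 ≤ j) → c d = 0 ∧ w₁ d = 0 ∧ w₀ d = 0) :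
    ∫ z, C z ∂m + ((∫ z, W₁ z ∂m) / k - (∫ z, W₀ z ∂m) / l) ≤
      h * (c origin + (w₁ origin / k - w₀ origin / l)) := by
  have hval : ∀ d, C (d.toQuad h) + (W₁ (d.toQuad h) / k - W₀ (d.toQuad h) / l) =
      h * (c d + (w₁ d / k - w₀ d / l)) := by
    intro d
    rw [hC, hW₁, hW₀]
    ring
  have hint : ∫ z, (C z + (W₁ z / k - W₀ z / l)) ∂m =
      ∫ z, C z ∂m + ((∫ z, W₁ z ∂m) / k - (∫ z, W₀ z ∂m) / l) := by
    have h1 : Integrable (fun z => W₁ z / k) m := hW₁i.div_const k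
    have h0 : Integrable (fun z => W₀ z / l) m := hW₀i.div_const l
    have h2 : Integrable (fun z => W₁ z / k - W₀ z / l) m := h1.sub h0
    rw [integral_add hCi h2, integral_sub h1 h0, integral_div, integral_div]
  rw [← hint, ← hval]
  refine hdom (fun z => C z + (W₁ z / k - W₀ z / l)) (by fun_prop) ?_ ?_
  · refine exists_bound_of_support
      (fun d => C (d.toQuad h) + (W₁ (d.toQuad h) / k - W₀ (d.toQuad h) / l)) i j fun d hd => ?_
    obtain ⟨h1, h2, h3⟩ := hsupp d hd
    rw [hval, h1, h2, h3]
    simp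
  · intro d hd
    simp only [hval]
    have h1 := hc d hd
    -- After division by `k` and `l` the window functions have Laplacians `-e₁` and `-e₀`. As `e =
    -- e₁ - e₀` bounds the Laplacian of the cell function, the defects cancel.
    have h2 : w₁ d.up / k + w₁ d.down / k - 2 * (w₁ d / k) = -e₁ d := by
      have := hw₁ d hd
      field_simp
      linarith
    have h3 : w₀ d.up / l + w₀ d.down / l - 2 * (w₀ d / l) = -e₀ d := by
      have := hw₀ d hd
      field_simp
      linarith
    rw [he] at h1
    nlinarith

/-- Exits through level `j` from the window with bottom `-(i + 1)` but not from the one with bottom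
`-i` occur with minimum exactly `-i`, so they are the entries into the plus cell. The difference of
the normalized window functions compensates the cell function there. -/
theorem integral_cellPlus_le [IsProbabilityMeasure m] (hh : 0 < h)
    (hm : ∀ᵐ z ∂m, ∃ d : LatticeState, d.Valid ∧ d.toQuad h = z)
    (hdom : IsSuperharmonicallyDominated h m) {i j : ℕ} (hij : ¬(i = 0 ∧ j = 0)) :
    ∫ z in cell (i * h) (j * h) 1, (j * h + h - z.X) ∂m ≤ h * psiPlus h m (i * h) (j * h) := by
  have hijR : (0 : ℝ) < i + j := by
    have : 0 < i + j := by omega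
    exact_mod_cast this
  have hmX := measurable_X
  have key := integral_cell_add_windows_le hh hdom
    (Measurable.indicator (by fun_prop) (measurableSet_cell _ _ _))
    (Measurable.indicator (by fun_prop) (measurableSet_window _ _))
    (Measurable.indicator (by fun_prop) (measurableSet_window _ _))
    (integrable_indicator_const_sub_X (j * h + h) (measurableSet_cell (i * h) (j * h) 1)
      (integrableOn_X_cell hh hm i j 1))
    (integrable_indicator_const_add_X ((i + 1 : ℕ) * h)
      (measurableSet_window ((i + 1 : ℕ) * h) (j * h)) (integrableOn_X_window hh hm (i + 1) j))
    (integrable_indicator_const_add_X (i * h)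
      (measurableSet_window (i * h) (j * h)) (integrableOn_X_window hh hm i j))
    (e := fun d => if d.2.1 + 1 = j ∧ d.1 = i ∧ d.2.2.1 = d.1 + d.2.1 then 1 else 0)
    (e₁ := fun d => if d.2.1 + 1 = j ∧ d.1 < i + 1 ∧ d.2.2.1 = d.1 + d.2.1 then 1 else 0)
    (e₀ := fun d => if d.2.1 + 1 = j ∧ d.1 < i ∧ d.2.2.1 = d.1 + d.2.1 then 1 else 0)
    (k := (i + 1 : ℕ) + j) (l := i + j) (i := i) (j := j)
    (indicator_cellPlus_toQuad hh i j) (indicator_windowUp_toQuad hh (i + 1) j)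
    (indicator_windowUp_toQuad hh i j) (by push_cast; linarith) hijR
    (cellPlus_laplacian_le i j _ fun _ => rfl)
    (fun d hd => (windowUp_laplacian (i + 1) j _ (fun _ => rfl) d hd).trans
      (by simp only [mul_ite, mul_one, mul_zero]))
    (fun d hd => (windowUp_laplacian i j _ (fun _ => rfl) d hd).trans
      (by simp only [mul_ite, mul_one, mul_zero]))
    (fun d => by split_ifs <;> first | omega | norm_num)
    (fun d hd => ⟨if_neg (by omega), if_neg (by omega), if_neg (by omega)⟩)
  rw [integral_indicator (measurableSet_cell _ _ _), integral_indicator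
    (measurableSet_window _ _), integral_indicator (measurableSet_window _ _)] at key
  -- The value at the origin. The cell term vanishes as the origin has signature `-1`. If `j = 0`
  -- both windows are empty, but both quotients on the right are `1` and cancel; if `i = 0` the
  -- smaller window is empty and its quotient is `0`.
  have hval : (if origin.2.1 = j ∧ origin.1 = i ∧ origin.2.2.2 = 1
      then (j + 1 - origin.2.2.1 + origin.1 : ℝ) else 0) +
      ((if origin.2.1 < j ∧ origin.1 < i + 1
        then ((i + 1 : ℕ) + origin.2.2.1 - origin.1 : ℝ) else 0) / ((i + 1 : ℕ) + j) -
      (if origin.2.1 < j ∧ origin.1 < i then (i + origin.2.2.1 - origin.1 : ℝ) else 0) / (i + j))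
      = (i + 1 : ℕ) / ((i + 1 : ℕ) + j) - i / (i + j) := by
    rw [if_neg fun hx => absurd hx.2.2 (by decide)]
    rcases Nat.eq_zero_or_pos j with rfl | hj
    · have e1 : ((i + 1 : ℕ) : ℝ) ≠ 0 := by positivity
      have e2 : (i : ℝ) ≠ 0 := by simpa using hijR.ne'
      rw [if_neg fun hx => absurd hx.1 (by simp), if_neg fun hx => absurd hx.1 (by simp)]
      rw [Nat.cast_zero, add_zero, add_zero, div_self e1, div_self e2]
      simp
    · rw [if_pos ⟨hj, Nat.succ_pos i⟩]
      rcases Nat.eq_zero_or_pos i with rfl | hi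
      · simp [origin]
      · rw [if_pos ⟨hj, hi⟩]
        simp [origin]
  rw [hval] at key
  rw [psiPlus_eq, phiUp_eq, phiUp_eq, ← add_mul, ← add_mul, sub_div, sub_div,
    mul_div_mul_right _ _ hh.ne', mul_div_mul_right _ _ hh.ne', div_mul_eq_div_div,
    div_mul_eq_div_div]
  have e : ∀ x y z w : ℝ, h * (x - y / h - (z - w / h)) = h * (x - z) - y + w := by
    intro x y z w; field_simp; ring
  rw [e]
  linarith

theorem integral_cellMinus_le [IsProbabilityMeasure m] (hh : 0 < h)
    (hm : ∀ᵐ z ∂m, ∃ d : LatticeState, d.Valid ∧ d.toQuad h = z)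
    (hdom : IsSuperharmonicallyDominated h m) {i j : ℕ} (hij : ¬(i = 0 ∧ j = 0)) :
    ∫ z in cell (i * h) (j * h) (-1), (i * h + h + z.X) ∂m ≤
      h * psiMinus h m (i * h) (j * h) := by
  have hijR : (0 : ℝ) < i + j := by
    have : 0 < i + j := by omega
    exact_mod_cast this
  have hmX := measurable_X
  have key := integral_cell_add_windows_le hh hdom
    (Measurable.indicator (by fun_prop) (measurableSet_cell _ _ _))
    (Measurable.indicator (by fun_prop) (measurableSet_window _ _))
    (Measurable.indicator (by fun_prop) (measurableSet_window _ _))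
    (integrable_indicator_const_add_X (i * h + h) (measurableSet_cell (i * h) (j * h) (-1))
      (integrableOn_X_cell hh hm i j (-1)))
    (integrable_indicator_const_sub_X ((j + 1 : ℕ) * h)
      (measurableSet_window (i * h) ((j + 1 : ℕ) * h)) (integrableOn_X_window hh hm i (j + 1)))
    (integrable_indicator_const_sub_X (j * h)
      (measurableSet_window (i * h) (j * h)) (integrableOn_X_window hh hm i j))
    (e := fun d => if d.2.1 = j ∧ d.1 + 1 = i ∧ d.2.2.1 = 0 then 1 else 0)
    (e₁ := fun d => if d.2.1 < j + 1 ∧ d.1 + 1 = i ∧ d.2.2.1 = 0 then 1 else 0)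
    (e₀ := fun d => if d.2.1 < j ∧ d.1 + 1 = i ∧ d.2.2.1 = 0 then 1 else 0)
    (k := i + (j + 1 : ℕ)) (l := i + j) (i := i) (j := j)
    (indicator_cellMinus_toQuad hh i j) (indicator_windowDown_toQuad hh i (j + 1))
    (indicator_windowDown_toQuad hh i j) (by push_cast; linarith) hijR
    (cellMinus_laplacian_le i j _ fun _ => rfl)
    (fun d hd => (windowDown_laplacian i (j + 1) _ (fun _ => rfl) d hd).trans
      (by simp only [mul_ite, mul_one, mul_zero]))
    (fun d hd => (windowDown_laplacian i j _ (fun _ => rfl) d hd).trans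
      (by simp only [mul_ite, mul_one, mul_zero]))
    (fun d => by split_ifs <;> first | omega | norm_num)
    (fun d hd => ⟨if_neg (by omega), if_neg (by omega), if_neg (by omega)⟩)
  rw [integral_indicator (measurableSet_cell _ _ _), integral_indicator
    (measurableSet_window _ _), integral_indicator (measurableSet_window _ _)] at key
  have hval : (if origin.2.1 = j ∧ origin.1 = i ∧ origin.2.2.2 = -1
      then (i + 1 + origin.2.2.1 - origin.1 : ℝ) else 0) +
      ((if origin.2.1 < j + 1 ∧ origin.1 < i
        then ((j + 1 : ℕ) - origin.2.2.1 + origin.1 : ℝ) else 0) / (i + (j + 1 : ℕ)) -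
      (if origin.2.1 < j ∧ origin.1 < i then (j - origin.2.2.1 + origin.1 : ℝ) else 0) / (i + j))
      = (j + 1 : ℕ) / (i + (j + 1 : ℕ)) - j / (i + j) := by
    -- The origin has signature `-1`, so here it is the exclusion of `(0, 0)` that keeps it out of
    -- the cell.
    rw [if_neg fun hx => hij ⟨hx.2.1.symm, hx.1.symm⟩]
    rcases Nat.eq_zero_or_pos i with rfl | hi
    · have e1 : ((j + 1 : ℕ) : ℝ) ≠ 0 := by positivity
      have e2 : (j : ℝ) ≠ 0 := by simpa using hijR.ne'
      rw [if_neg fun hx => absurd hx.2 (by simp), if_neg fun hx => absurd hx.2 (by simp)]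
      rw [Nat.cast_zero, zero_add, zero_add, zero_add, div_self e1, div_self e2]
      simp
    · rw [if_pos ⟨Nat.succ_pos j, hi⟩]
      rcases Nat.eq_zero_or_pos j with rfl | hj
      · simp [origin]
      · rw [if_pos ⟨hj, hi⟩]
        simp [origin]
  rw [hval] at key
  rw [psiMinus_eq, phiDown_eq, phiDown_eq, ← add_mul, ← add_mul, sub_div, sub_div,
    mul_div_mul_right _ _ hh.ne', mul_div_mul_right _ _ hh.ne', div_mul_eq_div_div,
    div_mul_eq_div_div]
  have e : ∀ x y z w : ℝ, h * (x - y / h - (z - w / h)) = h * (x - z) - y + w := by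
    intro x y z w; field_simp; ring
  rw [e]
  linarith

/-- At time `0` the signature is `-1`, and from time `1` on the maximum and minimum differ. -/
theorem measure_cell_zero_zero_one (hh : 0 < h) {Ω : Type*} {mΩ : MeasurableSpace Ω}
    {P : Measure Ω} [IsProbabilityMeasure P] {ℱ : Filtration ℕ mΩ} {ξ : ℕ → Ω → ℝ}
    (hξ : IsSymmetricSimpleRandomWalk P h ℱ ξ) (T : Ω → WithTop ℕ) :
    ∀ᵐ ω ∂P, stoppedValue (quadProcess ξ) T ω ∉ cell 0 0 1 := by
  filter_upwards [hξ.ae_increment hh 0, hξ.start] with ω hω h0 hmem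
  obtain ⟨hS, hI, hσ⟩ := hmem
  simp only [stoppedValue] at hS hI hσ
  generalize (T ω).untopA = n at hS hI hσ
  rcases Nat.eq_zero_or_pos n with rfl | hn
  · rw [quadProcess_zero] at hσ
    exact absurd (show (-1 : ℤˣ) = 1 from hσ) (by decide)
  · have h1 : runMin (fun k => ξ k ω) n ≤ ξ 1 ω := runMin_le (fun k => ξ k ω) hn
    have h2 : ξ 1 ω ≤ runMax (fun k => ξ k ω) n := le_runMax (fun k => ξ k ω) hn
    simp only [quadProcess, Quad.S, Quad.I] at hS hI
    rw [zero_add, h0] at hω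
    rcases hω with hω | hω <;> linarith

/-- Consistent laws satisfy the three conditions. -/
theorem IsConsistent.conditions (hh : 0 < h) (hm : IsConsistent.{u} h m) :
    (∀ᵐ z ∂m, z.I ≤ z.X ∧ z.X ≤ z.S) ∧
      (∀ i j : ℕ, ¬ (i = 0 ∧ j = 0) →
        CondPlus h m (i * h) (j * h) ∧ CondMinus h m (i * h) (j * h)) ∧
      m (cell 0 0 1) = 0 := by
  obtain ⟨Ω, mΩ, P, ℱ, ξ, T, hP, hξ, hT, hTfin, rfl⟩ := hm
  have hZ := measurable_stoppedQuad hξ hT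
  have : IsProbabilityMeasure (P.map (stoppedValue (quadProcess ξ) T)) :=
    Measure.isProbabilityMeasure_map hZ.aemeasurable
  have hl : ∀ᵐ z ∂(P.map (stoppedValue (quadProcess ξ) T)),
      ∃ d : LatticeState, d.Valid ∧ d.toQuad h = z := by
    have hcount : {z : Quad | ∃ d : LatticeState, d.Valid ∧ d.toQuad h = z}.Countable :=
      (Set.countable_range (toQuad h)).mono (by rintro z ⟨d, -, rfl⟩; exact ⟨d, rfl⟩)
    refine (ae_map_iff hZ.aemeasurable hcount.measurableSet).2 ?_
    filter_upwards [hξ.ae_lattice hh] with ω hω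
    exact hω _
  have hdom : IsSuperharmonicallyDominated h (P.map (stoppedValue (quadProcess ξ) T)) := by
    rintro f hf ⟨C, hC⟩ hsup
    rw [integral_map hZ.aemeasurable hf.aestronglyMeasurable]
    exact integral_stoppedQuad_le hh hξ hT hTfin hf hC hsup
  refine ⟨?_, fun i j hij => ⟨?_, ?_⟩, ?_⟩
  · filter_upwards [hl] with z hz
    exact ((exists_valid_toQuad_iff hh z).1 hz).2
  · exact ((condPlus_and_nonneg_iff hh hl i j).2 (integral_cellPlus_le hh hl hdom hij)).1
  · exact ((condMinus_and_nonneg_iff hh hl i j).2 (integral_cellMinus_le hh hl hdom hij)).1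
  · rw [Measure.map_apply hZ (measurableSet_cell _ _ _)]
    have := measure_cell_zero_zero_one hh hξ T
    rw [ae_iff] at this
    simp only [not_not] at this
    exact this

end Necessity

end StoppedWalk

namespace StoppedWalk

open LatticeState Filter Topology
open scoped ENNReal

/-! ### Randomized stopping driven by a flow -/

/-- Transition probabilities of the lattice states. -/
noncomputable def transition (e d : LatticeState) : ℝ≥0∞ :=
  2⁻¹ * (if e.up = d then 1 else 0) + 2⁻¹ * (if e.down = d then 1 else 0)

theorem tsum_transition_mul (e : LatticeState) (f : LatticeState → ℝ≥0∞) :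
    ∑' d, transition e d * f d = 2⁻¹ * f e.up + 2⁻¹ * f e.down := by
  simp only [transition, add_mul, mul_assoc, ENNReal.tsum_add, ENNReal.tsum_mul_left, ite_mul,
    one_mul, zero_mul]
  rw [tsum_ite_eq', tsum_ite_eq']

/-- A flow `F` of the lattice chain, started at the origin, that is absorbed with masses `M`. -/
structure IsFlow (F M : LatticeState → ℝ≥0∞) : Prop where
  ne_top : ∀ d, F d + M d ≠ ∞
  support : ∀ d : LatticeState, ¬d.Valid → F d + M d = 0
  balance : ∀ d, F d + M d = (if d = origin then 1 else 0) + ∑' e, F e * transition e d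

/-- The probability of being absorbed upon a visit. -/
noncomputable def stopProb (F M : LatticeState → ℝ≥0∞) (d : LatticeState) : ℝ≥0∞ :=
  M d / (F d + M d)

variable {F M : LatticeState → ℝ≥0∞}

theorem stopProb_le_one (d : LatticeState) : stopProb F M d ≤ 1 :=
  ENNReal.div_le_of_le_mul (by rw [one_mul]; exact le_add_self)

theorem IsFlow.stopProb_mul (hF : IsFlow F M) (d : LatticeState) :
    stopProb F M d * (F d + M d) = M d := by
  by_cases h0 : F d + M d = 0
  · rw [h0, mul_zero]; exact (add_eq_zero.1 h0).2.symm
  · exact ENNReal.div_mul_cancel h0 (hF.ne_top d)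

theorem IsFlow.one_sub_stopProb_mul (hF : IsFlow F M) (d : LatticeState) :
    (1 - stopProb F M d) * (F d + M d) = F d := by
  rw [ENNReal.sub_mul fun _ _ => hF.ne_top d, one_mul, hF.stopProb_mul]
  exact ENNReal.add_sub_cancel_right (ne_top_of_le_ne_top (hF.ne_top d) le_add_self)

/-- If the masses `A n` of unabsorbed visits follow the chain killed at rate `stopProb`, then the
total absorbed masses are `M`. -/
theorem IsFlow.stopProb_mul_tsum (hF : IsFlow F M) {A : ℕ → LatticeState → ℝ≥0∞}
    (hA0 : ∀ d, A 0 d = if d = origin then 1 else 0)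
    (hA : ∀ n d, A (n + 1) d = ∑' e, (1 - stopProb F M e) * A n e * transition e d)
    (d : LatticeState) : stopProb F M d * ∑' n, A n d = M d := by
  set r := stopProb F M with hr
  set G : LatticeState → ℝ≥0∞ := fun d => F d + M d with hG
  -- `G` plays the role of the expected number of visits: it solves the fixed-point equation of the
  -- visits of the killed chain.
  have hGeq : ∀ d, G d = (if d = origin then 1 else 0) +
      ∑' e, (1 - r e) * G e * transition e d := by
    intro d
    simp only [hr, hG, hF.one_sub_stopProb_mul]
    exact hF.balance d
  -- The partial sums of `A` are the iterates of this equation from `0`, hence stay below the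
  -- solution `G`.
  have hpart : ∀ N d, ∑ n ∈ Finset.range N, A n d ≤ G d := by
    intro N
    induction N with
    | zero => intro d; simp
    | succ N ih =>
      intro d
      rw [Finset.sum_range_succ', hA0, add_comm, hGeq]
      refine add_le_add le_rfl ?_
      simp only [hA]
      rw [← Summable.tsum_finsetSum fun _ _ => ENNReal.summable]
      refine ENNReal.tsum_le_tsum fun e => ?_
      rw [← Finset.sum_mul, ← Finset.mul_sum]
      gcongr
      exact ih e
  set B : LatticeState → ℝ≥0∞ := fun d => ∑' n, A n d with hB
  have hBG : ∀ d, B d ≤ G d := fun d =>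
    ENNReal.tsum_le_of_sum_range_le fun N => hpart N d
  have hBeq : ∀ d, B d = (if d = origin then 1 else 0) +
      ∑' e, (1 - r e) * B e * transition e d := by
    intro d
    simp only [hB]
    rw [tsum_eq_zero_add' ENNReal.summable, hA0]
    simp only [hA]
    rw [ENNReal.tsum_comm]
    simp only [ENNReal.tsum_mul_left, ENNReal.tsum_mul_right]
  -- The excess `D = G - B` solves the equation without source. It need not be shown to vanish; it
  -- is enough that it charges no state where stopping has positive probability.
  choose D hD using fun d => exists_add_of_le (hBG d)
  have hDle : ∀ d, D d ≤ G d := fun d => by rw [hD]; exact le_add_self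
  have hDtop : ∀ d, D d ≠ ∞ := fun d => ne_top_of_le_ne_top (hF.ne_top d) (hDle d)
  have hDeq : ∀ d, D d = ∑' e, (1 - r e) * D e * transition e d := by
    intro d
    have h1 : B d + D d = B d + ∑' e, (1 - r e) * D e * transition e d := by
      rw [← hD, hGeq]
      nth_rewrite 1 [hBeq]
      rw [add_assoc, ← ENNReal.tsum_add]
      congr 1
      refine tsum_congr fun e => ?_
      rw [hD e]
      ring
    exact (ENNReal.add_right_inj (ne_top_of_le_ne_top (hF.ne_top d) (hBG d))).1 h1
  have hDinv : ∀ d : LatticeState, ¬d.Valid → D d = 0 := fun d hd =>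
    le_antisymm ((hDle d).trans_eq (hF.support d hd)) zero_le
  have hrD : ∀ d, r d * D d = 0 := by
    intro d
    by_cases hd : d.Valid
    swap
    · rw [hDinv d hd, mul_zero]
    -- Minimum and maximum only spread, so the chain never returns to the box `W`. The mass of `D`
    -- in `W` is thus at most its part surviving the killing in `W`. Since `W` is finite this mass
    -- is finite, and nothing can have been killed.
    set W : Set LatticeState := {e | e.Valid ∧ e.1 ≤ d.1 ∧ e.2.1 ≤ d.2.1} with hW
    have hWfin : W.Finite := finite_valid_le d.1 d.2.1
    set I : LatticeState → ℝ≥0∞ := W.indicator 1 with hI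
    have hback : ∀ e : LatticeState, e.Valid → ∑' d', transition e d' * I d' ≤ I e := by
      intro e he
      rw [tsum_transition_mul]
      by_cases heW : e ∈ W
      · rw [hI, Set.indicator_of_mem heW]
        calc _ ≤ (2⁻¹ : ℝ≥0∞) * 1 + 2⁻¹ * 1 := by
              gcongr <;> exact Set.indicator_le_self' (fun _ _ => zero_le) _
          _ = 1 := by rw [mul_one]; exact ENNReal.inv_two_add_inv_two
      · have hu : e.up ∉ W := by
          obtain ⟨a, b, u, s⟩ := e
          intro hx
          refine heW ⟨he, ?_⟩
          have := hx.2
          simp only [LatticeState.up] at this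
          split_ifs at this <;> dsimp only at this ⊢ <;> omega
        have hdn : e.down ∉ W := by
          obtain ⟨a, b, u, s⟩ := e
          intro hx
          refine heW ⟨he, ?_⟩
          have := hx.2
          simp only [LatticeState.down] at this
          split_ifs at this <;> dsimp only at this ⊢ <;> omega
        simp [hI, hu, hdn]
    have hsum : ∑' e, D e * I e ≤ ∑' e, (1 - r e) * D e * I e := by
      calc ∑' d', D d' * I d' = ∑' d', ∑' e, (1 - r e) * D e * (transition e d' * I d') := by
            refine tsum_congr fun d' => ?_
            nth_rewrite 1 [hDeq]
            rw [← ENNReal.tsum_mul_right]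
            exact tsum_congr fun e => mul_assoc _ _ _
        _ = ∑' e, (1 - r e) * D e * ∑' d', transition e d' * I d' := by
            rw [ENNReal.tsum_comm]
            simp only [ENNReal.tsum_mul_left]
        _ ≤ ∑' e, (1 - r e) * D e * I e := by
            refine ENNReal.tsum_le_tsum fun e => ?_
            by_cases he : e.Valid
            · exact mul_le_mul_right (hback e he) _
            · simp [hDinv e he]
    have hfin : ∑' e, (1 - r e) * D e * I e ≠ ∞ := by
      rw [tsum_eq_sum (s := hWfin.toFinset) (fun e he => by
        rw [hI, Set.indicator_of_notMem (by simpa using he), mul_zero])]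
      refine (ENNReal.sum_lt_top.2 fun e _ => ?_).ne
      refine ENNReal.mul_lt_top (ENNReal.mul_lt_top ?_ (hDtop e).lt_top) ?_
      · exact tsub_le_self.trans_lt ENNReal.one_lt_top
      · exact (Set.indicator_le_self' (f := (1 : LatticeState → ℝ≥0∞))
          (fun _ _ => zero_le) e).trans_lt ENNReal.one_lt_top
    have hsplit : ∑' e, D e * I e =
        ∑' e, (1 - r e) * D e * I e + ∑' e, r e * D e * I e := by
      rw [← ENNReal.tsum_add]
      refine tsum_congr fun e => ?_
      rw [← add_mul, ← add_mul, tsub_add_cancel_of_le (stopProb_le_one e), one_mul]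
    rw [hsplit] at hsum
    have hz : ∑' e, r e * D e * I e = 0 := by
      have : ∑' e, (1 - r e) * D e * I e + ∑' e, r e * D e * I e ≤
        ∑' e, (1 - r e) * D e * I e + 0 := by simpa using hsum
      exact le_antisymm ((ENNReal.add_le_add_iff_left hfin).1 this) zero_le
    have := ENNReal.tsum_eq_zero.1 hz d
    rwa [hI, Set.indicator_of_mem (show d ∈ W from ⟨hd, le_rfl, le_rfl⟩), Pi.one_apply,
      mul_one] at this
  have := hF.stopProb_mul d
  change r d * G d = M d at this
  rw [← this, hD, mul_add, hrD, add_zero]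

end StoppedWalk

namespace StoppedWalk

open LatticeState Filter Topology
open scoped ENNReal

/-! ### The walk driven by coins and uniform seeds -/

/-- A coin toss together with a seed. -/
abbrev Seed : Type u := ULift.{u} (Bool × ℝ)

/-- The fair coin. -/
noncomputable def coinLaw : Measure Bool := (2⁻¹ : ℝ≥0∞) • Measure.dirac true +
  (2⁻¹ : ℝ≥0∞) • Measure.dirac false

/-- A fair coin and an independent uniform seed. -/
noncomputable def seedLaw : Measure Seed.{u} :=
  (coinLaw.prod (volume.restrict (Set.Icc (0 : ℝ) 1))).map ULift.up

instance : IsProbabilityMeasure coinLaw :=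
  ⟨by simp [coinLaw, ENNReal.inv_two_add_inv_two]⟩

instance : IsProbabilityMeasure (volume.restrict (Set.Icc (0 : ℝ) 1)) := ⟨by simp⟩

instance : IsProbabilityMeasure seedLaw.{u} :=
  Measure.isProbabilityMeasure_map measurable_up.aemeasurable

theorem coinLaw_apply (s : Set Bool) :
    coinLaw s = 2⁻¹ * s.indicator 1 true + 2⁻¹ * s.indicator 1 false := by
  simp [coinLaw]

theorem measurableSet_seed (s : Set Bool) {B : Set ℝ} (hB : MeasurableSet B) :
    MeasurableSet {x : Seed.{u} | x.down.1 ∈ s ∧ x.down.2 ∈ B} := by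
  have h1 : MeasurableSet {x : Seed.{u} | x.down.1 ∈ s} :=
    (measurable_fst.comp measurable_down) (MeasurableSet.of_discrete (s := s))
  have h2 : MeasurableSet {x : Seed.{u} | x.down.2 ∈ B} :=
    (measurable_snd.comp measurable_down) hB
  exact h1.inter h2

theorem seedLaw_apply (s : Set Bool) {B : Set ℝ} (hB : MeasurableSet B) :
    seedLaw.{u} {x | x.down.1 ∈ s ∧ x.down.2 ∈ B} =
      coinLaw s * volume.restrict (Set.Icc (0 : ℝ) 1) B := by
  rw [seedLaw, Measure.map_apply measurable_up (measurableSet_seed s hB), ← Measure.prod_prod]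
  rfl

theorem uniform_lt {t : ℝ≥0∞} (ht : t ≤ 1) :
    volume.restrict (Set.Icc (0 : ℝ) 1) {x | x < t.toReal} = t := by
  have ht' : t ≠ ∞ := ne_top_of_le_ne_top ENNReal.one_ne_top ht
  have h1 : t.toReal ≤ 1 := by
    rw [← ENNReal.toReal_one]; exact ENNReal.toReal_mono ENNReal.one_ne_top ht
  have hm : MeasurableSet {x : ℝ | x < t.toReal} := measurableSet_Iio
  rw [Measure.restrict_apply hm]
  have : {x : ℝ | x < t.toReal} ∩ Set.Icc 0 1 = Set.Ico 0 t.toReal := by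
    ext x
    simp only [Set.mem_inter_iff, Set.mem_ofPred_eq, Set.mem_Icc, Set.mem_Ico]
    constructor
    · rintro ⟨h1, h2, h3⟩; exact ⟨h2, h1⟩
    · rintro ⟨h2, h3⟩; exact ⟨h3, h2, by linarith⟩
  rw [this, Real.volume_Ico, sub_zero, ENNReal.ofReal_toReal ht']

theorem uniform_ge {t : ℝ≥0∞} (ht : t ≤ 1) :
    volume.restrict (Set.Icc (0 : ℝ) 1) {x | ¬x < t.toReal} = 1 - t := by
  have hm : MeasurableSet {x : ℝ | x < t.toReal} := measurableSet_Iio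
  have := prob_compl_eq_one_sub (μ := volume.restrict (Set.Icc (0 : ℝ) 1)) hm
  rw [uniform_lt ht] at this
  exact this

/-- The sample space: a sequence of coins and seeds. -/
abbrev SeedSpace : Type u := ℕ → Seed.{u}

/-- The law of i.i.d. coins and seeds. -/
noncomputable def seedMeasure : Measure SeedSpace.{u} := Measure.infinitePi fun _ => seedLaw.{u}

instance : IsProbabilityMeasure seedMeasure.{u} := by unfold seedMeasure; infer_instance

/-- The filtration generated by coins and seeds. -/
def seedFiltration : Filtration ℕ (inferInstance : MeasurableSpace SeedSpace.{u}) where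
  seq n := ⨆ k ∈ Set.Iic n, MeasurableSpace.comap (fun ω : SeedSpace.{u} => ω k) inferInstance
  mono' _ _ hij := iSup₂_le fun k hk =>
    le_iSup₂ (f := fun k (_ : k ∈ Set.Iic _) =>
      MeasurableSpace.comap (fun ω : SeedSpace.{u} => ω k) inferInstance) k (le_trans hk hij)
  le' _ := iSup₂_le fun k _ => (measurable_pi_apply k).comap_le

theorem measurable_seed {k n : ℕ} (hk : k ≤ n) :
    Measurable[seedFiltration.{u} n] fun ω : SeedSpace.{u} => ω k :=
  measurable_iff_comap_le.2 (le_iSup₂ (f := fun k (_ : k ∈ Set.Iic n) =>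
      MeasurableSpace.comap (fun ω : SeedSpace.{u} => ω k) inferInstance) k hk)

theorem indep_seed_succ (n : ℕ) :
    Indep (MeasurableSpace.comap (fun ω : SeedSpace.{u} => ω (n + 1)) inferInstance)
      (seedFiltration.{u} n) seedMeasure.{u} := by
  have hi : iIndepFun (fun (k : ℕ) (ω : SeedSpace.{u}) => ω k) seedMeasure.{u} :=
    iIndepFun_infinitePi (P := fun _ => seedLaw.{u}) (X := fun _ x => x) fun _ => measurable_id
  have := indep_iSup_of_disjoint (fun k => (measurable_pi_apply k).comap_le) hi.iIndep
    (S := {n + 1}) (T := Set.Iic n) (by simp)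
  rw [iSup_singleton] at this
  exact this

theorem seedMeasure_seed_succ (n : ℕ) {s : Set SeedSpace.{u}}
    (hs : MeasurableSet[seedFiltration.{u} n] s) {B : Set Seed.{u}} (hB : MeasurableSet B) :
    seedMeasure (s ∩ {ω | ω (n + 1) ∈ B}) = seedMeasure s * seedLaw B := by
  have hind := (Indep_iff _ _ _).1 (indep_seed_succ n) ((fun ω => ω (n + 1)) ⁻¹' B) s
    ⟨B, hB, rfl⟩ hs
  rw [Set.inter_comm, mul_comm]
  refine hind.trans ?_
  congr 1
  have := (measurePreserving_eval_infinitePi (fun _ : ℕ => seedLaw.{u}) (n + 1)).measure_preimage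
    hB.nullMeasurableSet
  exact this

/-- The lattice walk driven by the coins. -/
def latticeWalk (ω : SeedSpace.{u}) : ℕ → LatticeState
  | 0 => origin
  | n + 1 => if (ω (n + 1)).down.1 then (latticeWalk ω n).up else (latticeWalk ω n).down

theorem latticeWalk_valid (ω : SeedSpace.{u}) (n : ℕ) : (latticeWalk ω n).Valid := by
  induction n with
  | zero => simp [latticeWalk, origin, Valid]
  | succ n ih =>
    simp only [latticeWalk]
    split_ifs
    exacts [ih.up, ih.down]

theorem measurable_latticeWalk (n : ℕ) :
    Measurable[seedFiltration.{u} n] fun ω : SeedSpace.{u} => latticeWalk ω n := by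
  induction n with
  | zero => exact measurable_const
  | succ n ih =>
    simp only [latticeWalk]
    have h1 := ih.mono (seedFiltration.mono n.le_succ) le_rfl
    have h2 : Measurable[seedFiltration.{u} (n + 1)] fun ω : SeedSpace.{u} => (ω (n + 1)).down.1 :=
      (measurable_fst.comp measurable_down).comp (measurable_seed le_rfl)
    refine Measurable.ite (h2 (measurableSet_singleton true)) ?_ ?_
    · exact (measurable_of_countable LatticeState.up).comp h1
    · exact (measurable_of_countable LatticeState.down).comp h1

/-- The position of the lattice walk. -/
noncomputable def walkPath (h : ℝ) (n : ℕ) (ω : SeedSpace.{u}) : ℝ := ((latticeWalk ω n).toQuad h).X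

variable {h : ℝ}

theorem walkPath_succ_sub (hh : 0 < h) (n : ℕ) (ω : SeedSpace.{u}) :
    walkPath h (n + 1) ω - walkPath h n ω = if (ω (n + 1)).down.1 then h else -h := by
  have key : ∀ z d, (stepQuad z d).X = z.X + d := by
    intro z d
    unfold stepQuad
    split_ifs <;> rfl
  have hv := latticeWalk_valid ω n
  simp only [walkPath, latticeWalk]
  split_ifs
  · rw [← stepQuad_toQuad_up hh hv, key]; ring
  · rw [← stepQuad_toQuad_down hh hv, key]; ring

theorem quadProcess_walkPath (hh : 0 < h) (n : ℕ) (ω : SeedSpace.{u}) :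
    quadProcess (walkPath h) n ω = (latticeWalk ω n).toQuad h := by
  induction n with
  | zero =>
    rw [quadProcess_zero]
    simp [walkPath, latticeWalk, origin, toQuad, Quad.X]
  | succ n ih =>
    have hv := latticeWalk_valid ω n
    rw [quadProcess_succ, ih, walkPath_succ_sub hh]
    simp only [latticeWalk]
    split_ifs
    · exact stepQuad_toQuad_up hh hv
    · exact stepQuad_toQuad_down hh hv

theorem isSymmetricSimpleRandomWalk_walkPath (hh : 0 < h) :
    IsSymmetricSimpleRandomWalk seedMeasure.{u} h seedFiltration.{u} (walkPath h) where
  adapted n := (measurable_of_countable fun d : LatticeState => (d.toQuad h).X).comp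
    (measurable_latticeWalk n)
  start := ae_of_all _ fun ω => by simp [walkPath, latticeWalk, origin, toQuad, Quad.X]
  indep n := by
    refine indep_of_indep_of_le_left (indep_seed_succ n) ?_
    simp only [walkPath_succ_sub hh]
    refine Measurable.comap_le ?_
    have h2 : Measurable fun x : Seed.{u} => if x.down.1 then h else -h :=
      Measurable.ite ((measurable_fst.comp measurable_down) (measurableSet_singleton true))
        measurable_const measurable_const
    exact h2.comp (comap_measurable _)
  step_up n := by
    have := seedMeasure_seed_succ.{u} n MeasurableSet.univ 
      (measurableSet_seed {true} MeasurableSet.univ)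
    rw [seedLaw_apply _ MeasurableSet.univ, coinLaw_apply] at this
    simp only [walkPath_succ_sub hh]
    have hne : -h ≠ h := by linarith
    simpa [hne] using this
  step_down n := by
    have := seedMeasure_seed_succ.{u} n MeasurableSet.univ 
      (measurableSet_seed {false} MeasurableSet.univ)
    rw [seedLaw_apply _ MeasurableSet.univ, coinLaw_apply] at this
    simp only [walkPath_succ_sub hh]
    have hne : h ≠ -h := by linarith
    simpa [hne] using this

end StoppedWalk

namespace StoppedWalk

open LatticeState Filter Topology
open scoped ENNReal

/-! ### The stopping time of a flow -/

/-- The seed at time `n` calls for stopping, when stopping at `d` has probability `r d`. -/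
def Stops (r : LatticeState → ℝ≥0∞) (n : ℕ) (ω : SeedSpace.{u}) : Prop :=
  (ω n).down.2 < (r (latticeWalk ω n)).toReal

/-- The event of visiting `d` at time `n`, not having stopped before. -/
def visit (r : LatticeState → ℝ≥0∞) (n : ℕ) (d : LatticeState) : Set SeedSpace.{u} :=
  {ω | latticeWalk ω n = d ∧ ∀ k < n, ¬Stops r k ω}

open Classical in
/-- The first time at which the seed calls for stopping. -/
noncomputable def firstStop (r : LatticeState → ℝ≥0∞) (ω : SeedSpace.{u}) : WithTop ℕ :=
  if hex : ∃ n, Stops r n ω then WithTop.some (Nat.find hex) else ⊤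

variable {r : LatticeState → ℝ≥0∞}

theorem firstStop_le_iff (ω : SeedSpace.{u}) (n : ℕ) :
    firstStop r ω ≤ WithTop.some n ↔ ∃ k ≤ n, Stops r k ω := by
  classical
  unfold firstStop
  split_ifs with hex
  · rw [WithTop.coe_le_coe, Nat.find_le_iff]
  · simp only [top_le_iff, WithTop.coe_ne_top, false_iff]
    exact fun ⟨k, _, hk⟩ => hex ⟨k, hk⟩

theorem firstStop_eq {ω : SeedSpace.{u}} {n : ℕ} (hn : Stops r n ω)
    (hlt : ∀ k < n, ¬Stops r k ω) : firstStop r ω = WithTop.some n := by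
  classical
  have hex : ∃ n, Stops r n ω := ⟨n, hn⟩
  unfold firstStop
  rw [dif_pos hex]
  congr 1
  exact (Nat.find_eq_iff hex).2 ⟨hn, hlt⟩

theorem measurableSet_stops {k n : ℕ} (hk : k ≤ n) :
    MeasurableSet[seedFiltration.{u} n] {ω : SeedSpace.{u} | Stops r k ω} := by
  have h1 : Measurable[seedFiltration.{u} n] fun ω : SeedSpace.{u} => (ω k).down.2 :=
    (measurable_snd.comp measurable_down).comp (measurable_seed hk)
  have h2 : Measurable[seedFiltration.{u} n] fun ω : SeedSpace.{u} =>
      (r (latticeWalk ω k)).toReal :=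
    (measurable_of_countable fun d : LatticeState => (r d).toReal).comp
      ((measurable_latticeWalk k).mono (seedFiltration.mono hk) le_rfl)
  exact measurableSet_lt h1 h2

theorem measurableSet_visit (n : ℕ) (d : LatticeState) :
    MeasurableSet[seedFiltration.{u} n] (visit.{u} r n d) := by
  have h1 : MeasurableSet[seedFiltration.{u} n] {ω : SeedSpace.{u} | latticeWalk ω n = d} :=
    measurable_latticeWalk n (measurableSet_singleton d)
  have h2 : MeasurableSet[seedFiltration.{u} n]
      {ω : SeedSpace.{u} | ∀ k < n, ¬Stops r k ω} := by
    have : {ω : SeedSpace.{u} | ∀ k < n, ¬Stops r k ω} =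
        ⋂ k ∈ Set.Iio n, {ω : SeedSpace.{u} | Stops r k ω}ᶜ := by
      ext ω; simp
    rw [this]
    exact MeasurableSet.biInter (Set.to_countable _) fun k hk =>
      (measurableSet_stops (le_of_lt hk)).compl
  exact h1.inter h2

theorem isStoppingTime_firstStop : IsStoppingTime seedFiltration.{u} (firstStop.{u} r) := by
  intro n
  have : {ω : SeedSpace.{u} | firstStop r ω ≤ WithTop.some n} =
      ⋃ k ∈ Set.Iic n, {ω : SeedSpace.{u} | Stops r k ω} := by
    ext ω
    simp only [Set.mem_ofPred_eq, Set.mem_iUnion, Set.mem_Iic, exists_prop]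
    exact firstStop_le_iff ω n
  rw [this]
  exact MeasurableSet.biUnion (Set.to_countable _) fun k hk => measurableSet_stops hk

/-- The coin at time `n + 1` decides the move, while the seed at the same time is independent of
that coin and of the past. So on arrival at `d` the seed is still uniform and available for the
stopping decision. -/
theorem seedMeasure_visit_succ (n : ℕ) (d : LatticeState) {B : Set ℝ} (hB : MeasurableSet B) :
    seedMeasure (visit.{u} r (n + 1) d ∩ {ω | (ω (n + 1)).down.2 ∈ B}) =
      (∑' e, seedMeasure (visit.{u} r n e ∩ {ω | ¬Stops r n ω}) * transition e d) *
        volume.restrict (Set.Icc (0 : ℝ) 1) B := by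
  have hset : visit.{u} r (n + 1) d ∩ {ω | (ω (n + 1)).down.2 ∈ B} =
      ⋃ e, (visit.{u} r n e ∩ {ω | ¬Stops r n ω}) ∩ {ω | ω (n + 1) ∈ {x : Seed.{u} |
        x.down.1 ∈ {b : Bool | (if b then e.up else e.down) = d} ∧ x.down.2 ∈ B}} := by
    ext ω
    simp only [visit, latticeWalk, Set.mem_inter_iff, Set.mem_ofPred_eq, Set.mem_iUnion,
      Nat.lt_succ_iff_lt_or_eq]
    constructor
    · rintro ⟨⟨h1, h2⟩, h3⟩
      exact ⟨latticeWalk ω n, ⟨⟨rfl, fun k hk => h2 k (Or.inl hk)⟩, h2 n (Or.inr rfl)⟩, h1, h3⟩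
    · rintro ⟨e, ⟨⟨rfl, h2⟩, h3⟩, h4, h5⟩
      refine ⟨⟨h4, ?_⟩, h5⟩
      rintro k (hk | rfl)
      exacts [h2 k hk, h3]
  have hms : ∀ e, MeasurableSet[seedFiltration.{u} n]
      (visit.{u} r n e ∩ {ω | ¬Stops r n ω}) := fun e =>
    (measurableSet_visit n e).inter (measurableSet_stops le_rfl).compl
  have hsd : ∀ e : LatticeState, MeasurableSet {x : Seed.{u} |
      x.down.1 ∈ {b : Bool | (if b then e.up else e.down) = d} ∧ x.down.2 ∈ B} := fun e =>
    measurableSet_seed _ hB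
  rw [hset, measure_iUnion, ← ENNReal.tsum_mul_right]
  · refine tsum_congr fun e => ?_
    rw [seedMeasure_seed_succ n (hms e) (hsd e), seedLaw_apply _ hB, coinLaw_apply, mul_assoc]
    simp [transition, Set.indicator]
  · intro e e' hee
    refine Set.disjoint_left.2 fun ω h1 h2 => hee ?_
    exact h1.1.1.1.symm.trans h2.1.1.1
  · intro e
    exact (seedFiltration.le n _ (hms e)).inter (measurable_pi_apply (n + 1) (hsd e))

theorem seedMeasure_visit_stops (hr : ∀ d, r d ≤ 1) (n : ℕ) (d : LatticeState) :
    seedMeasure (visit.{u} r n d ∩ {ω | Stops r n ω}) = r d * seedMeasure (visit.{u} r n d) ∧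
    seedMeasure (visit.{u} r n d ∩ {ω | ¬Stops r n ω}) =
      (1 - r d) * seedMeasure (visit.{u} r n d) := by
  have hm1 : MeasurableSet {x : ℝ | x < (r d).toReal} := measurableSet_Iio
  have hm2 : MeasurableSet {x : ℝ | ¬x < (r d).toReal} := measurableSet_Iio.compl
  have e1 : visit.{u} r n d ∩ {ω | Stops r n ω} =
      visit.{u} r n d ∩ {ω | (ω n).down.2 ∈ {x : ℝ | x < (r d).toReal}} := by
    ext ω
    refine and_congr_right fun hω => ?_
    simp only [Stops, hω.1, Set.mem_ofPred_eq]
  have e2 : visit.{u} r n d ∩ {ω | ¬Stops r n ω} =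
      visit.{u} r n d ∩ {ω | (ω n).down.2 ∈ {x : ℝ | ¬x < (r d).toReal}} := by
    ext ω
    refine and_congr_right fun hω => ?_
    simp only [Stops, hω.1, Set.mem_ofPred_eq]
  have e0 : visit.{u} r n d = visit.{u} r n d ∩ {ω | (ω n).down.2 ∈ Set.univ} := by simp
  -- On the visit event the seed has a multiple of the uniform law. The constant is left implicit;
  -- `B = univ` identifies it as the probability of the visit.
  have key : ∃ c, ∀ B : Set ℝ, MeasurableSet B →
      seedMeasure (visit.{u} r n d ∩ {ω | (ω n).down.2 ∈ B}) =
        c * volume.restrict (Set.Icc (0 : ℝ) 1) B := by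
    cases n with
    | succ n => exact ⟨_, fun B hB => seedMeasure_visit_succ n d hB⟩
    | zero =>
      by_cases hd : d = origin
      · refine ⟨1, fun B hB => ?_⟩
        have hv : visit.{u} r 0 d = Set.univ := by
          ext ω; simp [visit, latticeWalk, hd]
        have := (measurePreserving_eval_infinitePi (fun _ : ℕ => seedLaw.{u}) 0).measure_preimage
          (measurableSet_seed Set.univ hB).nullMeasurableSet
        rw [seedLaw_apply _ hB, measure_univ] at this
        rw [hv, Set.univ_inter, ← this]
        simp [seedMeasure, Set.preimage]
      · refine ⟨0, fun B _ => ?_⟩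
        have hv : visit.{u} r 0 d = ∅ := by
          ext ω; simp [visit, latticeWalk, Ne.symm hd]
        simp [hv]
  obtain ⟨c, hc⟩ := key
  rw [e1, e2, hc _ hm1, hc _ hm2, uniform_lt (hr d), uniform_ge (hr d), e0, hc _ MeasurableSet.univ,
    measure_univ, mul_one]
  exact ⟨mul_comm _ _, mul_comm _ _⟩

variable {F M : LatticeState → ℝ≥0∞}

/-- The masses absorbed by the walk stopped according to the flow. -/
theorem IsFlow.tsum_seedMeasure_visit_stops (hF : IsFlow F M) (d : LatticeState) :
    ∑' n, seedMeasure (visit.{u} (stopProb F M) n d ∩ {ω | Stops (stopProb F M) n ω}) = M d := by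
  have hr : ∀ d, stopProb F M d ≤ 1 := stopProb_le_one
  simp only [(seedMeasure_visit_stops hr _ _).1, ENNReal.tsum_mul_left]
  refine hF.stopProb_mul_tsum (A := fun n d => seedMeasure (visit.{u} (stopProb F M) n d)) ?_ ?_ d
  · intro d
    split_ifs with hd
    · have : visit.{u} (stopProb F M) 0 d = Set.univ := by
        ext ω; simp [visit, latticeWalk, hd]
      rw [this, measure_univ]
    · have : visit.{u} (stopProb F M) 0 d = ∅ := by
        ext ω; simp [visit, latticeWalk, Ne.symm hd]
      rw [this, measure_empty]
  · intro n d
    have := seedMeasure_visit_succ.{u} (r := stopProb F M) n d MeasurableSet.univ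
    simp only [Set.mem_univ, Set.ofPred_true, Set.inter_univ, measure_univ, mul_one] at this
    rw [this]
    simp only [(seedMeasure_visit_stops hr _ _).2]

theorem measure_le_of_singleton_le {α : Type*} [MeasurableSpace α] [MeasurableSingletonClass α]
    {μ ν : Measure α} {S : Set α} (hS : S.Countable) (hμ : ∀ᵐ x ∂μ, x ∈ S)
    (hle : ∀ x ∈ S, μ {x} ≤ ν {x}) : μ ≤ ν := by
  refine Measure.le_iff.2 fun B hB => ?_
  have hBS : (B ∩ S).Countable := hS.mono Set.inter_subset_right
  have e : ∀ κ : Measure α, κ (B ∩ S) = ∑' x : ↥(B ∩ S), κ {(x : α)} := by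
    intro κ
    have := measure_biUnion (μ := κ) hBS (f := fun x => {x})
      (fun x _ y _ hxy => by simpa [Function.onFun] using hxy)
      (fun x _ => measurableSet_singleton x)
    rwa [Set.biUnion_of_singleton] at this
  calc μ B = μ (B ∩ S) := by
        refine measure_congr ?_
        filter_upwards [hμ] with x hx
        exact propext ⟨fun h => ⟨h, hx⟩, fun h => h.1⟩
    _ = ∑' x : ↥(B ∩ S), μ {(x : α)} := e μ
    _ ≤ ∑' x : ↥(B ∩ S), ν {(x : α)} := ENNReal.tsum_le_tsum fun x => hle x x.2.2
    _ = ν (B ∩ S) := (e ν).symm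
    _ ≤ ν B := measure_mono Set.inter_subset_left

/-- A law absorbed by a flow is consistent. -/
theorem IsFlow.isConsistent {h : ℝ} (hh : 0 < h) {m : Measure Quad} [IsProbabilityMeasure m]
    (hm : ∀ᵐ z ∂m, ∃ d : LatticeState, d.Valid ∧ d.toQuad h = z)
    (hF : IsFlow F fun d => m {d.toQuad h}) : IsConsistent.{u} h m := by
  set r := stopProb F fun d => m {d.toQuad h} with hr
  have hξ := isSymmetricSimpleRandomWalk_walkPath.{u} hh
  have hT := isStoppingTime_firstStop.{u} (r := r)
  have hZ := measurable_stoppedQuad hξ hT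
  set fin : Set SeedSpace.{u} := {ω | firstStop r ω ≠ ⊤} with hfin
  have hfinm : MeasurableSet fin :=
    hT.measurable' (measurableSet_singleton ⊤).compl
  set μ : Measure Quad := (seedMeasure.{u}.restrict fin).map
    (stoppedValue (quadProcess (walkPath h)) (firstStop r)) with hμ
  -- Only this inequality needs checking, on lattice points. Since `m` has mass `1`, it forces the
  -- stopping time to be finite almost surely, and then equality of two probability measures.
  have hmμ : m ≤ μ := by
    refine measure_le_of_singleton_le (S := Set.range (toQuad h)) (Set.countable_range _) ?_ ?_
    · filter_upwards [hm] with z hz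
      obtain ⟨d, -, rfl⟩ := hz
      exact ⟨d, rfl⟩
    · rintro _ ⟨d, rfl⟩
      rw [hμ, Measure.map_apply hZ (measurableSet_singleton _),
        Measure.restrict_apply (hZ (measurableSet_singleton _)),
        ← hF.tsum_seedMeasure_visit_stops d, ← hr, ← measure_iUnion]
      · refine measure_mono (Set.iUnion_subset fun n => ?_)
        rintro ω ⟨⟨h1, h2⟩, h3⟩
        have hT' := firstStop_eq h3 h2
        refine ⟨?_, by rw [hfin, Set.mem_ofPred_eq, hT']; exact WithTop.coe_ne_top⟩
        have : stoppedValue (quadProcess (walkPath h)) (firstStop r) ω =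
            quadProcess (walkPath h) n ω := by
          simp only [stoppedValue, hT']
          rfl
        rw [Set.mem_preimage, this, quadProcess_walkPath hh, h1]
        rfl
      · intro n n' hnn
        refine Set.disjoint_left.2 fun ω h1 h2 => hnn ?_
        have := (firstStop_eq h1.2 h1.1.2).symm.trans (firstStop_eq h2.2 h2.1.2)
        exact WithTop.coe_injective this
      · intro n
        exact seedFiltration.le n _ ((measurableSet_visit n d).inter (measurableSet_stops le_rfl))
  have hfin1 : seedMeasure fin = 1 := by
    refine le_antisymm prob_le_one ?_
    have := hmμ Set.univ
    rwa [measure_univ, hμ, Measure.map_apply hZ MeasurableSet.univ, Set.preimage_univ,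
      Measure.restrict_apply_univ] at this
  have hae : ∀ᵐ ω ∂seedMeasure.{u}, firstStop r ω ≠ ⊤ :=
    (prob_compl_eq_zero_iff hfinm).2 hfin1
  refine ⟨SeedSpace.{u}, inferInstance, seedMeasure, seedFiltration, walkPath h, firstStop r,
    inferInstance, hξ, hT, hae, ?_⟩
  rw [hμ, Measure.restrict_eq_self_of_ae_mem (s := fin) hae] at hmμ
  have : IsProbabilityMeasure (seedMeasure.{u}.map
      (stoppedValue (quadProcess (walkPath h)) (firstStop r))) :=
    Measure.isProbabilityMeasure_map hZ.aemeasurable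
  exact (Measure.eq_of_le_of_measure_univ_eq hmμ (by rw [measure_univ, measure_univ])).symm

end StoppedWalk

namespace StoppedWalk

open LatticeState Filter Topology
open scoped ENNReal

/-! ### The discrete potential of a cell -/

/-- The solution of `K u + μ u = (K (u - 1) + K (u + 1)) / 2` with `K (-1) = 0`, `K 0 = 2 * p`. -/
noncomputable def potential (p : ℝ) (μ : ℕ → ℝ) (u : ℕ) : ℝ :=
  2 * (p * (u + 1) + ∑ y ∈ Finset.range u, μ y * (u - y))

theorem potential_zero (p : ℝ) (μ : ℕ → ℝ) : potential p μ 0 = 2 * p := by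
  simp [potential]

theorem potential_nonneg {p : ℝ} {μ : ℕ → ℝ} (hp : 0 ≤ p) (hμ : ∀ y, 0 ≤ μ y) (u : ℕ) :
    0 ≤ potential p μ u := by
  refine mul_nonneg zero_le_two (add_nonneg (by positivity) (Finset.sum_nonneg fun y hy => ?_))
  have : (y : ℝ) ≤ u := by exact_mod_cast (Finset.mem_range.1 hy).le
  exact mul_nonneg (hμ y) (by linarith)

/-- Conservation across an edge: the net downward flux from `u + 1` to `u` is absorbed at the levels
up to `u` or leaves through the bottom. -/
theorem potential_succ_sub (p : ℝ) (μ : ℕ → ℝ) (u : ℕ) :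
    potential p μ (u + 1) - potential p μ u = 2 * (p + ∑ y ∈ Finset.range (u + 1), μ y) := by
  have : ∀ s : Finset ℕ, ∑ y ∈ s, μ y * ((u + 1 : ℕ) - y : ℝ) =
      ∑ y ∈ s, μ y * (u - y : ℝ) + ∑ y ∈ s, μ y := by
    intro s
    rw [← Finset.sum_add_distrib]
    exact Finset.sum_congr rfl fun y _ => by push_cast; ring
  unfold potential
  rw [this, Finset.sum_range_succ (fun y => μ y * (u - y : ℝ)), sub_self, mul_zero]
  push_cast
  ring

theorem potential_balance_zero (p : ℝ) (μ : ℕ → ℝ) :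
    potential p μ 0 + μ 0 = potential p μ 1 / 2 := by
  have := potential_succ_sub p μ 0
  rw [potential_zero] at *
  simp at this
  linarith

theorem potential_balance_succ (p : ℝ) (μ : ℕ → ℝ) (u : ℕ) :
    potential p μ (u + 1) + μ (u + 1) = potential p μ u / 2 + potential p μ (u + 2) / 2 := by
  have h1 := potential_succ_sub p μ u
  have h2 := potential_succ_sub p μ (u + 1)
  rw [Finset.sum_range_succ] at h2
  linarith

/-! ### Fluxes through the cells -/

section Flux

variable {h : ℝ} {m : Measure Quad}

/-- The flux that reaches the level `j` before the level `-i`. -/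
noncomputable def reachUp (h : ℝ) (m : Measure Quad) (i j : ℕ) : ℝ :=
  1 - phiDown m (i * h) (j * h) - m.real (window (i * h) (j * h))

/-- The flux entering the cell `(i, j, 1)`. -/
noncomputable def entryPlus (h : ℝ) (m : Measure Quad) (i j : ℕ) : ℝ :=
  reachUp h m (i + 1) j - reachUp h m i j

/-- The flux entering the cell `(i, j, -1)`. -/
noncomputable def entryMinus (h : ℝ) (m : Measure Quad) (i j : ℕ) : ℝ :=
  phiDown m (i * h) ((j + 1 : ℕ) * h) - phiDown m (i * h) (j * h)

/-- The flux from the cell `(i, j, 1)` to a new minimum. -/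
noncomputable def exitDown (h : ℝ) (m : Measure Quad) (i j : ℕ) : ℝ :=
  (entryPlus h m i j - (∫ z in cell (i * h) (j * h) 1, (j * h + h - z.X) ∂m) / h) / (i + j + 2)

/-- The flux from the cell `(i, j, -1)` to a new maximum. -/
noncomputable def exitUp (h : ℝ) (m : Measure Quad) (i j : ℕ) : ℝ :=
  (entryMinus h m i j - (∫ z in cell (i * h) (j * h) (-1), (i * h + h + z.X) ∂m) / h) /
    (i + j + 2)

theorem measure_window_eq_zero (hh : 0 < h)
    (hm : ∀ᵐ z ∂m, ∃ d : LatticeState, d.Valid ∧ d.toQuad h = z) {i j : ℕ}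
    (hij : i = 0 ∨ j = 0) : m (window (i * h) (j * h)) = 0 := by
  have : ∀ᵐ z ∂m, z ∉ window (i * h) (j * h) := by
    filter_upwards [hm] with z hz
    obtain ⟨d, -, rfl⟩ := hz
    rw [toQuad_mem_window hh]
    omega
  simp only [ae_iff, not_not] at this
  exact this

/-- Inclusion-exclusion: the windows `(i, j + 1)` and `(i + 1, j)` meet in `(i, j)`, and together
they miss from `(i + 1, j + 1)` only the corner `S = j, I = -i`, which splits by signature. -/
theorem setIntegral_window_succ_succ (hh : 0 < h)
    (hm : ∀ᵐ z ∂m, ∃ d : LatticeState, d.Valid ∧ d.toQuad h = z) (i j : ℕ) {f : Quad → ℝ}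
    (hw : ∀ i j : ℕ, IntegrableOn f (window (i * h) (j * h)) m)
    (hc : ∀ (i j : ℕ) (s : ℤˣ), IntegrableOn f (cell (i * h) (j * h) s) m) :
    ∫ z in window ((i + 1 : ℕ) * h) ((j + 1 : ℕ) * h), f z ∂m +
        ∫ z in window (i * h) (j * h), f z ∂m =
      ∫ z in window (i * h) ((j + 1 : ℕ) * h), f z ∂m +
        ∫ z in window ((i + 1 : ℕ) * h) (j * h), f z ∂m +
        (∫ z in cell (i * h) (j * h) 1, f z ∂m + ∫ z in cell (i * h) (j * h) (-1), f z ∂m) := by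
  have iw : ∀ i j : ℕ, Integrable ((window (i * h) (j * h)).indicator f) m := fun i j =>
    (hw i j).integrable_indicator (measurableSet_window _ _)
  have ic : ∀ (i j : ℕ) (s : ℤˣ), Integrable ((cell (i * h) (j * h) s).indicator f) m :=
    fun i j s => (hc i j s).integrable_indicator (measurableSet_cell _ _ _)
  simp only [← integral_indicator (measurableSet_window _ _),
    ← integral_indicator (measurableSet_cell _ _ _)]
  rw [← integral_add' (iw _ _) (iw _ _), ← integral_add' (iw _ _) (iw _ _),
    ← integral_add' (ic _ _ _) (ic _ _ _),
    ← integral_add' ((iw _ _).add (iw _ _)) ((ic _ _ _).add (ic _ _ _))]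
  refine integral_congr_ae ?_
  filter_upwards [hm] with z hz
  obtain ⟨⟨a, b, u, s⟩, -, rfl⟩ := hz
  simp only [Pi.add_apply, indicator_window_toQuad hh, indicator_cell_toQuad hh]
  generalize f _ = x
  have hne : (1 : ℤˣ) ≠ -1 := by decide
  by_cases hab : b = j ∧ a = i
  · obtain ⟨rfl, rfl⟩ := hab
    rcases Int.units_eq_one_or s with rfl | rfl <;> simp [hne, hne.symm]
  · have h1 : ∀ t : ℤˣ, ¬(b = j ∧ a = i ∧ s = t) := fun t ht => hab ⟨ht.1, ht.2.1⟩
    rw [if_neg (h1 _), if_neg (h1 _)]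
    split_ifs <;> first | omega | simp

/-- The case `i = 0` is included: there `phiDown` is `0 / 0 = 0`. This is why `reachUp` is built
from `phiDown`; the default value of `phiUp` at `(0, 0)` would be `0` instead of `1`. -/
theorem reachUp_zero_right (hh : 0 < h)
    (hm : ∀ᵐ z ∂m, ∃ d : LatticeState, d.Valid ∧ d.toQuad h = z) (i : ℕ) :
    reachUp h m i 0 = 1 := by
  have h0 := measure_window_eq_zero hh hm (i := i) (j := 0) (Or.inr rfl)
  rw [reachUp, phiDown_eq, setIntegral_measure_zero _ h0, measureReal_def, h0]
  simp

theorem phiDown_zero_left (hh : 0 < h)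
    (hm : ∀ᵐ z ∂m, ∃ d : LatticeState, d.Valid ∧ d.toQuad h = z) (j : ℕ) :
    phiDown m ((0 : ℕ) * h) (j * h) = if j = 0 then 0 else 1 := by
  have h0 := measure_window_eq_zero hh hm (i := 0) (j := j) (Or.inl rfl)
  rw [phiDown_eq, setIntegral_measure_zero _ h0]
  split_ifs with hj
  · simp [hj]
  · have : (j : ℝ) * h ≠ 0 := by positivity
    simp [this]

theorem entryPlus_zero_right (hh : 0 < h)
    (hm : ∀ᵐ z ∂m, ∃ d : LatticeState, d.Valid ∧ d.toQuad h = z) (i : ℕ) :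
    entryPlus h m i 0 = 0 := by
  rw [entryPlus, reachUp_zero_right hh hm, reachUp_zero_right hh hm, sub_self]

/-- The value `1` at `j = 0` comes from `phiDown = 0 / 0 = 0` at `(0, 0)`: the unit mass started at
the origin is counted as flux entering the minus cell `(0, 0)`. -/
theorem entryMinus_zero_left (hh : 0 < h)
    (hm : ∀ᵐ z ∂m, ∃ d : LatticeState, d.Valid ∧ d.toQuad h = z) (j : ℕ) :
    entryMinus h m 0 j = if j = 0 then 1 else 0 := by
  rw [entryMinus, phiDown_zero_left hh hm, phiDown_zero_left hh hm]
  rw [if_neg (Nat.succ_ne_zero j)]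
  split_ifs <;> norm_num

variable [IsProbabilityMeasure m]

theorem phiDown_mul (hh : 0 < h)
    (hm : ∀ᵐ z ∂m, ∃ d : LatticeState, d.Valid ∧ d.toQuad h = z) (i j : ℕ) :
    phiDown m (i * h) (j * h) * (i + j) = j - j * m.real (window (i * h) (j * h)) +
      (∫ z in window (i * h) (j * h), z.X ∂m) / h := by
  by_cases hij : (i : ℝ) + j = 0
  · have hi : (i : ℝ) = 0 := by
      have h1 : (0 : ℝ) ≤ i := by positivity
      have h2 : (0 : ℝ) ≤ j := by positivity
      linarith
    have hj : (j : ℝ) = 0 := by linarith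
    have h0 := measure_window_eq_zero hh hm (i := i) (j := j) (Or.inl (by exact_mod_cast hi))
    rw [hij, setIntegral_measure_zero _ h0, hj]
    simp
  · rw [phiDown_eq, setIntegral_const_sub_X _ (integrableOn_X_window hh hm i j), ← add_mul]
    have := hh.ne'
    field_simp
    ring

theorem reachUp_mul (hh : 0 < h)
    (hm : ∀ᵐ z ∂m, ∃ d : LatticeState, d.Valid ∧ d.toQuad h = z) (i j : ℕ) :
    reachUp h m i j * (i + j) = i - i * m.real (window (i * h) (j * h)) -
      (∫ z in window (i * h) (j * h), z.X ∂m) / h := by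
  have := phiDown_mul hh hm i j
  unfold reachUp
  linear_combination -this

theorem reachUp_eq_phiUp (hh : 0 < h)
    (hm : ∀ᵐ z ∂m, ∃ d : LatticeState, d.Valid ∧ d.toQuad h = z) {i j : ℕ}
    (hij : ¬(i = 0 ∧ j = 0)) : reachUp h m i j = phiUp m (i * h) (j * h) := by
  have hijR : (0 : ℝ) < i + j := by
    have : 0 < i + j := by omega
    exact_mod_cast this
  have h1 := reachUp_mul hh hm i j
  rw [phiUp_eq, setIntegral_const_add_X _ (integrableOn_X_window hh hm i j), ← add_mul,
    eq_div_iff (by positivity), ← mul_assoc, h1]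
  field_simp
  ring

theorem measureReal_window_succ_succ (hh : 0 < h)
    (hm : ∀ᵐ z ∂m, ∃ d : LatticeState, d.Valid ∧ d.toQuad h = z) (i j : ℕ) :
    m.real (window ((i + 1 : ℕ) * h) ((j + 1 : ℕ) * h)) + m.real (window (i * h) (j * h)) =
      m.real (window (i * h) ((j + 1 : ℕ) * h)) + m.real (window ((i + 1 : ℕ) * h) (j * h)) +
        (m.real (cell (i * h) (j * h) 1) + m.real (cell (i * h) (j * h) (-1))) := by
  have := setIntegral_window_succ_succ hh hm i j (f := fun _ => 1)
    (fun _ _ => integrable_const _) (fun _ _ _ => integrable_const _)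
  simpa only [setIntegral_const, smul_eq_mul, mul_one] using this

theorem exitDown_mul (hh : 0 < h)
    (hm : ∀ᵐ z ∂m, ∃ d : LatticeState, d.Valid ∧ d.toQuad h = z) (i j : ℕ) :
    exitDown h m i j * (i + j + 2) = reachUp h m (i + 1) j - reachUp h m i j -
      (j + 1) * m.real (cell (i * h) (j * h) 1) +
      (∫ z in cell (i * h) (j * h) 1, z.X ∂m) / h := by
  rw [exitDown, div_mul_cancel₀ _ (by positivity),
    setIntegral_const_sub_X _ (integrableOn_X_cell hh hm i j 1), entryPlus]
  have := hh.ne'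
  field_simp
  ring

theorem exitUp_mul (hh : 0 < h)
    (hm : ∀ᵐ z ∂m, ∃ d : LatticeState, d.Valid ∧ d.toQuad h = z) (i j : ℕ) :
    exitUp h m i j * (i + j + 2) =
      reachUp h m i j + m.real (window (i * h) (j * h)) - reachUp h m i (j + 1) -
      m.real (window (i * h) ((j + 1 : ℕ) * h)) -
      (i + 1) * m.real (cell (i * h) (j * h) (-1)) -
      (∫ z in cell (i * h) (j * h) (-1), z.X ∂m) / h := by
  rw [exitUp, div_mul_cancel₀ _ (by positivity),
    setIntegral_const_add_X _ (integrableOn_X_cell hh hm i j (-1)), entryMinus, reachUp, reachUp]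
  have := hh.ne'
  field_simp
  ring

/-- The plus cell `(i, j + 1)` is entered from the tops of both cells at `(i, j)`. From the plus
cell comes what entered it and neither left downwards nor stopped; from the minus cell comes
`exitUp`. -/
theorem entryPlus_succ (hh : 0 < h)
    (hm : ∀ᵐ z ∂m, ∃ d : LatticeState, d.Valid ∧ d.toQuad h = z) (i j : ℕ) :
    entryPlus h m i (j + 1) = (entryPlus h m i j - exitDown h m i j -
      m.real (cell (i * h) (j * h) 1)) + exitUp h m i j := by
  have hX := congrArg (· / h) (setIntegral_window_succ_succ hh hm i j
    (integrableOn_X_window hh hm) (integrableOn_X_cell hh hm))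
  simp only [add_div] at hX
  have hN := measureReal_window_succ_succ hh hm i j
  have e11 := reachUp_mul hh hm (i + 1) (j + 1)
  have e10 := reachUp_mul hh hm (i + 1) j
  have e01 := reachUp_mul hh hm i (j + 1)
  have e00 := reachUp_mul hh hm i j
  have hp := exitDown_mul hh hm i j
  have hq := exitUp_mul hh hm i j
  have hL : ((i : ℝ) + j + 2) ≠ 0 := by positivity
  -- After multiplication by `i + j + 2` the identity combines the relations defining the fluxes
  -- with inclusion-exclusion for mass (`hN`) and for position (`hX`).
  refine mul_right_cancel₀ hL ?_
  rw [entryPlus, entryPlus]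
  push_cast at e11 e10 e01 e00 hp hq hX hN ⊢
  linear_combination e11 - e01 - e10 + e00 + hp - hq - (i + 1) * hN - hX

theorem entryMinus_succ (hh : 0 < h)
    (hm : ∀ᵐ z ∂m, ∃ d : LatticeState, d.Valid ∧ d.toQuad h = z) (i j : ℕ) :
    entryMinus h m (i + 1) j = exitDown h m i j + (entryMinus h m i j - exitUp h m i j -
      m.real (cell (i * h) (j * h) (-1))) := by
  have hX := congrArg (· / h) (setIntegral_window_succ_succ hh hm i j
    (integrableOn_X_window hh hm) (integrableOn_X_cell hh hm))
  simp only [add_div] at hX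
  have hN := measureReal_window_succ_succ hh hm i j
  have e11 := reachUp_mul hh hm (i + 1) (j + 1)
  have e10 := reachUp_mul hh hm (i + 1) j
  have e01 := reachUp_mul hh hm i (j + 1)
  have e00 := reachUp_mul hh hm i j
  have hp := exitDown_mul hh hm i j
  have hq := exitUp_mul hh hm i j
  have hL : ((i : ℝ) + j + 2) ≠ 0 := by positivity
  refine mul_right_cancel₀ hL ?_
  have d : ∀ i j : ℕ, phiDown m (i * h) (j * h) =
      1 - reachUp h m i j - m.real (window (i * h) (j * h)) := by
    intro i j; unfold reachUp; ring
  rw [entryMinus, entryMinus, d, d, d, d]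
  push_cast at e11 e10 e01 e00 hp hq hX hN ⊢
  linear_combination -e11 + e10 + e01 - e00 - hp + hq - (j + 1) * hN + hX

end Flux

end StoppedWalk

namespace StoppedWalk

open LatticeState Filter Topology
open scoped ENNReal

/-! ### Flows inside the cells and positivity of the fluxes -/

section Flux

variable {h : ℝ} {m : Measure Quad}

/-- The mass of `m` at a lattice state. -/
noncomputable def massAt (h : ℝ) (m : Measure Quad) (d : LatticeState) : ℝ := m.real {d.toQuad h}

theorem massAt_nonneg (d : LatticeState) : 0 ≤ massAt h m d := measureReal_nonneg

/-- The flow through the cell `(i, j, 1)`. -/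
noncomputable def flowPlus (h : ℝ) (m : Measure Quad) (i j u : ℕ) : ℝ :=
  potential (exitDown h m i j) (fun y => massAt h m (i, j, y, 1)) u

/-- The flow through the cell `(i, j, -1)`, read from the maximum downwards. -/
noncomputable def flowMinus (h : ℝ) (m : Measure Quad) (i j u : ℕ) : ℝ :=
  potential (exitUp h m i j) (fun y => massAt h m (i, j, i + j - y, -1)) u

theorem sum_reflect_massAt (i j : ℕ) (g : ℕ → ℝ) :
    ∑ y ∈ Finset.range (i + j + 1), massAt h m (i, j, i + j - y, -1) * g (i + j - y) =
      ∑ y ∈ Finset.range (i + j + 1), massAt h m (i, j, y, -1) * g y := by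
  have := Finset.sum_range_reflect (fun y => massAt h m (i, j, y, -1) * g y) (i + j + 1)
  simpa using this

variable [IsProbabilityMeasure m]

theorem setIntegral_cell (hh : 0 < h)
    (hm : ∀ᵐ z ∂m, ∃ d : LatticeState, d.Valid ∧ d.toQuad h = z) (i j : ℕ) (s : ℤˣ)
    (f : Quad → ℝ) : ∫ z in cell (i * h) (j * h) s, f z ∂m =
      ∑ u ∈ Finset.range (i + j + 1), massAt h m (i, j, u, s) * f (toQuad h (i, j, u, s)) := by
  let φ : ℕ ↪ Quad := ⟨fun u => toQuad h (i, j, u, s), fun u v huv => by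
    have := toQuad_injective hh huv
    simpa using this⟩
  have hset : (cell (i * h) (j * h) s : Set Quad) =ᵐ[m]
      (((Finset.range (i + j + 1)).map φ : Finset Quad) : Set Quad) := by
    refine eventuallyEq_set.2 ?_
    filter_upwards [hm] with z hz
    obtain ⟨⟨a, b, u, t⟩, hd, rfl⟩ := hz
    simp only [Valid] at hd
    refine ⟨fun hx => ?_, fun hx => ?_⟩
    · obtain ⟨h1, h2, h3⟩ := (toQuad_mem_cell hh i j s _).1 hx
      dsimp only at h1 h2 h3
      subst h1 h2 h3
      have hu : u ∈ Finset.range (a + b + 1) := Finset.mem_range.2 (by omega)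
      exact Finset.mem_coe.2 (Finset.mem_map.2 ⟨u, hu, rfl⟩)
    · obtain ⟨v, -, hv⟩ := Finset.mem_map.1 (Finset.mem_coe.1 hx)
      exact hv ▸ (toQuad_mem_cell hh i j s (i, j, v, s)).2 ⟨rfl, rfl, rfl⟩
  rw [setIntegral_congr_set hset, setIntegral_finset _ IntegrableOn.finset, Finset.sum_map]
  rfl

theorem measureReal_cell (hh : 0 < h)
    (hm : ∀ᵐ z ∂m, ∃ d : LatticeState, d.Valid ∧ d.toQuad h = z) (i j : ℕ) (s : ℤˣ) :
    m.real (cell (i * h) (j * h) s) =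
      ∑ u ∈ Finset.range (i + j + 1), massAt h m (i, j, u, s) := by
  have := setIntegral_cell hh hm i j s fun _ => 1
  simpa only [setIntegral_const, smul_eq_mul, mul_one] using this

/-- `exitDown` is chosen as the initial value for which the potential takes this value one level
above the top. In the balance at the top, half of it stands for the inflow from other cells. -/
theorem flowPlus_last_succ (hh : 0 < h)
    (hm : ∀ᵐ z ∂m, ∃ d : LatticeState, d.Valid ∧ d.toQuad h = z) (i j : ℕ) :
    flowPlus h m i j (i + j + 1) = 2 * entryPlus h m i j := by
  have h1 : exitDown h m i j * (i + j + 2) = _ := div_mul_cancel₀ _ (by positivity)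
  rw [setIntegral_cell hh hm] at h1
  have h2 : (∑ u ∈ Finset.range (i + j + 1), massAt h m (i, j, u, 1) *
      (j * h + h - (toQuad h (i, j, u, 1)).X)) / h =
      ∑ u ∈ Finset.range (i + j + 1), massAt h m (i, j, u, 1) * ((i + j + 1 : ℕ) - u) := by
    rw [Finset.sum_div]
    refine Finset.sum_congr rfl fun u _ => ?_
    rw [toQuad_X]
    push_cast
    field_simp
    ring
  rw [h2] at h1
  unfold flowPlus potential
  push_cast at h1 ⊢
  linear_combination 2 * h1

theorem flowMinus_last_succ (hh : 0 < h)
    (hm : ∀ᵐ z ∂m, ∃ d : LatticeState, d.Valid ∧ d.toQuad h = z) (i j : ℕ) :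
    flowMinus h m i j (i + j + 1) = 2 * entryMinus h m i j := by
  have h1 : exitUp h m i j * (i + j + 2) = _ := div_mul_cancel₀ _ (by positivity)
  rw [setIntegral_cell hh hm] at h1
  have h2 : (∑ u ∈ Finset.range (i + j + 1), massAt h m (i, j, u, -1) *
      (i * h + h + (toQuad h (i, j, u, -1)).X)) / h =
      ∑ u ∈ Finset.range (i + j + 1), massAt h m (i, j, u, -1) * (u + 1 : ℝ) := by
    rw [Finset.sum_div]
    refine Finset.sum_congr rfl fun u _ => ?_
    rw [toQuad_X]
    push_cast
    field_simp
    ring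
  have h3 : ∑ u ∈ Finset.range (i + j + 1), massAt h m (i, j, u, -1) * (u + 1 : ℝ) =
      ∑ y ∈ Finset.range (i + j + 1), massAt h m (i, j, i + j - y, -1) *
        ((i + j + 1 : ℕ) - y) := by
    rw [← sum_reflect_massAt i j fun y => (y + 1 : ℝ)]
    refine Finset.sum_congr rfl fun y hy => ?_
    rw [Nat.cast_sub (by have := Finset.mem_range.1 hy; omega)]
    push_cast
    ring
  rw [h2, h3] at h1
  unfold flowMinus potential
  push_cast at h1 ⊢
  linear_combination 2 * h1

/-- Conservation in the cell: half of the flow at the top is the flux to a new maximum, that is, the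
entry flux less the downward exit and the stopped mass. -/
theorem flowPlus_last (hh : 0 < h)
    (hm : ∀ᵐ z ∂m, ∃ d : LatticeState, d.Valid ∧ d.toQuad h = z) (i j : ℕ) :
    flowPlus h m i j (i + j) =
      2 * (entryPlus h m i j - exitDown h m i j - m.real (cell (i * h) (j * h) 1)) := by
  have h1 := flowPlus_last_succ hh hm i j
  have h2 := potential_succ_sub (exitDown h m i j) (fun y => massAt h m (i, j, y, 1)) (i + j)
  rw [← measureReal_cell hh hm] at h2
  unfold flowPlus at *
  linarith

theorem flowMinus_last (hh : 0 < h)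
    (hm : ∀ᵐ z ∂m, ∃ d : LatticeState, d.Valid ∧ d.toQuad h = z) (i j : ℕ) :
    flowMinus h m i j (i + j) =
      2 * (entryMinus h m i j - exitUp h m i j - m.real (cell (i * h) (j * h) (-1))) := by
  have h1 := flowMinus_last_succ hh hm i j
  have h2 := potential_succ_sub (exitUp h m i j)
    (fun y => massAt h m (i, j, i + j - y, -1)) (i + j)
  have h3 := sum_reflect_massAt (h := h) (m := m) i j fun _ => 1
  simp only [mul_one] at h3
  rw [h3, ← measureReal_cell hh hm] at h2
  unfold flowMinus at *
  linarith

/-- The conditions of the theorem, for a law on the lattice. -/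
structure EmbeddingConditions (h : ℝ) (m : Measure Quad) : Prop where
  lattice : ∀ᵐ z ∂m, ∃ d : LatticeState, d.Valid ∧ d.toQuad h = z
  cond : ∀ i j : ℕ, ¬(i = 0 ∧ j = 0) → CondPlus h m (i * h) (j * h) ∧ CondMinus h m (i * h) (j * h)
  cell_origin : m (cell 0 0 1) = 0

/-- The numerator of `exitDown` is nonnegative by the cross-multiplied condition 2, available
because the entry flux is nonnegative. At `(0, 0)`, where condition 2 is not assumed, condition 3
takes its place. -/
theorem EmbeddingConditions.exitDown_nonneg (hh : 0 < h) (hc : EmbeddingConditions h m) {i j : ℕ}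
    (he : 0 ≤ entryPlus h m i j) : 0 ≤ exitDown h m i j := by
  refine div_nonneg ?_ (by positivity)
  rw [sub_nonneg, div_le_iff₀ hh, mul_comm (entryPlus h m i j)]
  by_cases hij : i = 0 ∧ j = 0
  · obtain ⟨rfl, rfl⟩ := hij
    have : m (cell ((0 : ℕ) * h) ((0 : ℕ) * h) 1) = 0 := by simpa using hc.cell_origin
    rw [setIntegral_measure_zero _ this]
    positivity
  · have hψ : psiPlus h m (i * h) (j * h) = entryPlus h m i j := by
      rw [psiPlus_eq, entryPlus, reachUp_eq_phiUp hh hc.lattice (by omega),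
        reachUp_eq_phiUp hh hc.lattice hij]
    rw [← hψ] at he ⊢
    exact (condPlus_and_nonneg_iff hh hc.lattice i j).1 ⟨(hc.cond i j hij).1, he⟩

theorem EmbeddingConditions.exitUp_nonneg (hh : 0 < h) (hc : EmbeddingConditions h m) {i j : ℕ}
    (he : 0 ≤ entryMinus h m i j) : 0 ≤ exitUp h m i j := by
  refine div_nonneg ?_ (by positivity)
  rw [sub_nonneg, div_le_iff₀ hh, mul_comm (entryMinus h m i j)]
  by_cases hij : i = 0 ∧ j = 0
  · obtain ⟨rfl, rfl⟩ := hij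
    -- The cell of the origin has a single level and entry flux `1`, so the claim is that the mass
    -- at the origin is at most `1`.
    rw [entryMinus_zero_left hh hc.lattice, if_pos rfl, setIntegral_cell hh hc.lattice]
    have : massAt h m (0, 0, 0, -1) ≤ 1 := measureReal_le_one
    simp [toQuad, Quad.X]
    nlinarith
  · have hψ : psiMinus h m (i * h) (j * h) = entryMinus h m i j := by
      rw [psiMinus_eq, entryMinus]
    rw [← hψ] at he ⊢
    exact (condMinus_and_nonneg_iff hh hc.lattice i j).1 ⟨(hc.cond i j hij).2, he⟩

/-- Nonnegative entries on the diagonal `i + j = n` give nonnegative exits and flows there, and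
these add up to the entries on the next diagonal. Plus cells with `j = 0` and minus cells with `i =
0` have explicit entry fluxes. -/
theorem EmbeddingConditions.entry_nonneg (hh : 0 < h) (hc : EmbeddingConditions h m) (n : ℕ) :
    ∀ i j : ℕ, i + j = n → 0 ≤ entryPlus h m i j ∧ 0 ≤ entryMinus h m i j := by
  induction n with
  | zero =>
    intro i j hij
    obtain ⟨rfl, rfl⟩ : i = 0 ∧ j = 0 := by omega
    rw [entryPlus_zero_right hh hc.lattice, entryMinus_zero_left hh hc.lattice]
    simp
  | succ n ih =>
    intro i j hij
    constructor
    · cases j with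
      | zero => rw [entryPlus_zero_right hh hc.lattice]
      | succ j =>
        obtain ⟨h1, h2⟩ := ih i j (by omega)
        have h3 : 0 ≤ flowPlus h m i j (i + j) :=
          potential_nonneg (hc.exitDown_nonneg hh h1) (fun y => massAt_nonneg _) _
        rw [flowPlus_last hh hc.lattice] at h3
        rw [entryPlus_succ hh hc.lattice]
        have := hc.exitUp_nonneg hh h2
        linarith
    · cases i with
      | zero =>
        rw [entryMinus_zero_left hh hc.lattice]
        split_ifs <;> norm_num
      | succ i =>
        obtain ⟨h1, h2⟩ := ih i j (by omega)
        have h3 : 0 ≤ flowMinus h m i j (i + j) :=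
          potential_nonneg (hc.exitUp_nonneg hh h2) (fun y => massAt_nonneg _) _
        rw [flowMinus_last hh hc.lattice] at h3
        rw [entryMinus_succ hh hc.lattice]
        have := hc.exitDown_nonneg hh h1
        linarith

theorem EmbeddingConditions.flowPlus_nonneg (hh : 0 < h) (hc : EmbeddingConditions h m)
    (i j u : ℕ) : 0 ≤ flowPlus h m i j u :=
  potential_nonneg (hc.exitDown_nonneg hh (hc.entry_nonneg hh _ i j rfl).1)
    (fun _ => massAt_nonneg _) _

theorem EmbeddingConditions.flowMinus_nonneg (hh : 0 < h) (hc : EmbeddingConditions h m)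
    (i j u : ℕ) : 0 ≤ flowMinus h m i j u :=
  potential_nonneg (hc.exitUp_nonneg hh (hc.entry_nonneg hh _ i j rfl).2)
    (fun _ => massAt_nonneg _) _

end Flux

end StoppedWalk

namespace StoppedWalk

open LatticeState Filter Topology
open scoped ENNReal

/-! ### Predecessors of a lattice state -/

section Predecessors

variable {g : LatticeState → ℝ≥0∞}

theorem up_eq_iff {e : LatticeState} (he : e.Valid) (a b u : ℕ) (s : ℤˣ) :
    e.up = (a, b, u, s) ↔
      (∃ v, u = v + 1 ∧ u ≤ a + b ∧ e = (a, b, v, s)) ∨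
      (∃ c t, b = c + 1 ∧ u = a + b ∧ s = 1 ∧ e = (a, c, a + c, t)) := by
  obtain ⟨α, β, w, t⟩ := e
  simp only [Valid] at he
  simp only [LatticeState.up]
  split_ifs with hw
  · simp only [Prod.mk.injEq]
    constructor
    · rintro ⟨rfl, rfl, rfl, rfl⟩
      exact Or.inl ⟨w, rfl, hw, rfl, rfl, rfl, rfl⟩
    · rintro (⟨v, rfl, h1, rfl, rfl, rfl, rfl⟩ | ⟨c, t, rfl, rfl, rfl, rfl, rfl, rfl, rfl⟩)
      · exact ⟨rfl, rfl, rfl, rfl⟩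
      · omega
  · simp only [Prod.mk.injEq]
    constructor
    · rintro ⟨rfl, rfl, rfl, rfl⟩
      exact Or.inr ⟨β, t, rfl, by omega, rfl, rfl, rfl, by omega, rfl⟩
    · rintro (⟨v, rfl, h1, rfl, rfl, rfl, rfl⟩ | ⟨c, t, rfl, rfl, rfl, rfl, rfl, rfl, rfl⟩)
      · omega
      · exact ⟨rfl, rfl, by omega, rfl⟩

theorem down_eq_iff {e : LatticeState} (he : e.Valid) (a b u : ℕ) (s : ℤˣ) :
    e.down = (a, b, u, s) ↔
      (u + 1 ≤ a + b ∧ e = (a, b, u + 1, s)) ∨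
      (∃ c t, a = c + 1 ∧ u = 0 ∧ s = -1 ∧ e = (c, b, 0, t)) := by
  obtain ⟨α, β, w, t⟩ := e
  simp only [Valid] at he
  simp only [LatticeState.down]
  split_ifs with hw
  · simp only [Prod.mk.injEq]
    constructor
    · rintro ⟨rfl, rfl, rfl, rfl⟩
      exact Or.inl ⟨by omega, rfl, rfl, by omega, rfl⟩
    · rintro (⟨h1, rfl, rfl, rfl, rfl⟩ | ⟨c, t, rfl, rfl, rfl, rfl, rfl, rfl, rfl⟩)
      · exact ⟨rfl, rfl, rfl, rfl⟩
      · omega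
  · simp only [Prod.mk.injEq]
    constructor
    · rintro ⟨rfl, rfl, rfl, rfl⟩
      exact Or.inr ⟨α, t, rfl, rfl, rfl, rfl, rfl, by omega, rfl⟩
    · rintro (⟨h1, rfl, rfl, rfl, rfl⟩ | ⟨c, t, rfl, rfl, rfl, rfl, rfl, rfl, rfl⟩)
      · omega
      · exact ⟨rfl, rfl, rfl, rfl⟩

theorem tsum_ite_eq_zero {p : LatticeState → Prop} [DecidablePred p]
    (hg : ∀ d : LatticeState, ¬d.Valid → g d = 0) (hp : ∀ e : LatticeState, e.Valid → ¬p e) :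
    ∑' e, g e * (if p e then 1 else 0) = 0 := by
  refine ENNReal.tsum_eq_zero.2 fun e => ?_
  by_cases he : e.Valid
  · rw [if_neg (hp e he), mul_zero]
  · rw [hg e he, zero_mul]

theorem tsum_ite_eq_single {p : LatticeState → Prop} [DecidablePred p]
    (hg : ∀ d : LatticeState, ¬d.Valid → g d = 0) {e₁ : LatticeState}
    (hp : ∀ e : LatticeState, e.Valid → (p e ↔ e = e₁)) :
    ∑' e, g e * (if p e then 1 else 0) = g e₁ := by
  rw [← tsum_ite_eq e₁ g]
  refine tsum_congr fun e => ?_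
  by_cases he : e.Valid
  · by_cases h : e = e₁
    · rw [if_pos ((hp e he).2 h), if_pos h, mul_one]
    · rw [if_neg (fun hx => h ((hp e he).1 hx)), if_neg h, mul_zero]
  · rw [hg e he, zero_mul, ite_self]

theorem tsum_ite_eq_three {p : LatticeState → Prop} [DecidablePred p]
    (hg : ∀ d : LatticeState, ¬d.Valid → g d = 0) {e₁ e₂ e₃ : LatticeState}
    (h12 : e₁ ≠ e₂) (h13 : e₁ ≠ e₃) (h23 : e₂ ≠ e₃)
    (hp : ∀ e : LatticeState, e.Valid → (p e ↔ e = e₁ ∨ e = e₂ ∨ e = e₃)) :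
    ∑' e, g e * (if p e then 1 else 0) = g e₁ + (g e₂ + g e₃) := by
  rw [← tsum_ite_eq e₁ g, ← tsum_ite_eq e₂ g, ← tsum_ite_eq e₃ g, ← ENNReal.tsum_add,
    ← ENNReal.tsum_add]
  refine tsum_congr fun e => ?_
  by_cases he : e.Valid
  · have := hp e he
    by_cases h1 : e = e₁
    · subst h1
      rw [if_pos (this.2 (Or.inl rfl))]
      simp [h12, h13]
    by_cases h2 : e = e₂
    · subst h2
      rw [if_pos (this.2 (Or.inr (Or.inl rfl)))]
      simp [h1, h23]
    by_cases h3 : e = e₃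
    · subst h3
      rw [if_pos (this.2 (Or.inr (Or.inr rfl)))]
      simp [h1, h2]
    rw [if_neg (by rw [this]; tauto)]
    simp [h1, h2, h3]
  · rw [hg e he]
    simp

theorem tsum_up_zero (hg : ∀ d : LatticeState, ¬d.Valid → g d = 0) (a b : ℕ) (s : ℤˣ) :
    ∑' e, g e * (if e.up = (a, b, 0, s) then 1 else 0) = 0 := by
  refine tsum_ite_eq_zero hg fun e he hx => ?_
  rw [up_eq_iff he] at hx
  obtain ⟨v, h1, -⟩ | ⟨c, t, h1, h2, -⟩ := hx <;> omega

/-- The hypothesis `hs` leaves out the top of a plus cell with `b > 0`, the one place where upward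
steps also arrive from other cells; `tsum_up_top` treats it. -/
theorem tsum_up_succ (hg : ∀ d : LatticeState, ¬d.Valid → g d = 0) {a b u : ℕ} {s : ℤˣ}
    (hu : u + 1 ≤ a + b) (hs : s = 1 → u + 1 = a + b → b = 0) :
    ∑' e, g e * (if e.up = (a, b, u + 1, s) then 1 else 0) = g (a, b, u, s) := by
  refine tsum_ite_eq_single hg fun e he => ?_
  rw [up_eq_iff he]
  constructor
  · rintro (⟨v, h1, h2, rfl⟩ | ⟨c, t, h1, h2, h3, -⟩)
    · obtain rfl : u = v := by omega
      rfl
    · have := hs h3 h2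
      omega
  · rintro rfl
    exact Or.inl ⟨u, rfl, hu, rfl⟩

theorem tsum_up_top (hg : ∀ d : LatticeState, ¬d.Valid → g d = 0) (a b : ℕ) :
    ∑' e, g e * (if e.up = (a, b + 1, a + b + 1, 1) then 1 else 0) =
      g (a, b + 1, a + b, 1) + (g (a, b, a + b, 1) + g (a, b, a + b, -1)) := by
  have hne : (1 : ℤˣ) ≠ -1 := by decide
  refine tsum_ite_eq_three hg (by simp) (by simp) (by simp [hne]) fun e he => ?_
  rw [up_eq_iff he]
  constructor
  · rintro (⟨v, h1, h2, rfl⟩ | ⟨c, t, h1, h2, h3, rfl⟩)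
    · obtain rfl : a + b = v := by omega
      exact Or.inl rfl
    · obtain rfl : b = c := by omega
      rcases Int.units_eq_one_or t with rfl | rfl
      exacts [Or.inr (Or.inl rfl), Or.inr (Or.inr rfl)]
  · rintro (rfl | rfl | rfl)
    · exact Or.inl ⟨a + b, rfl, by omega, rfl⟩
    · exact Or.inr ⟨b, 1, rfl, by omega, rfl, rfl⟩
    · exact Or.inr ⟨b, -1, rfl, by omega, rfl, rfl⟩

theorem tsum_down_top (hg : ∀ d : LatticeState, ¬d.Valid → g d = 0) {a b u : ℕ} {s : ℤˣ}
    (hu : u = a + b) : ∑' e, g e * (if e.down = (a, b, u, s) then 1 else 0) = 0 := by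
  refine tsum_ite_eq_zero hg fun e he hx => ?_
  rw [down_eq_iff he] at hx
  obtain ⟨h1, -⟩ | ⟨c, t, h1, h2, -⟩ := hx <;> omega

theorem tsum_down_of_lt (hg : ∀ d : LatticeState, ¬d.Valid → g d = 0) {a b u : ℕ} {s : ℤˣ}
    (hu : u + 1 ≤ a + b) (hs : s = -1 → u = 0 → a = 0) :
    ∑' e, g e * (if e.down = (a, b, u, s) then 1 else 0) = g (a, b, u + 1, s) := by
  refine tsum_ite_eq_single hg fun e he => ?_
  rw [down_eq_iff he]
  constructor
  · rintro (⟨h2, rfl⟩ | ⟨c, t, h1, h2, h3, -⟩)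
    · rfl
    · have := hs h3 h2
      omega
  · rintro rfl
    exact Or.inl ⟨hu, rfl⟩

theorem tsum_down_bottom (hg : ∀ d : LatticeState, ¬d.Valid → g d = 0) (a b : ℕ) :
    ∑' e, g e * (if e.down = (a + 1, b, 0, -1) then 1 else 0) =
      g (a + 1, b, 1, -1) + (g (a, b, 0, 1) + g (a, b, 0, -1)) := by
  have hne : (1 : ℤˣ) ≠ -1 := by decide
  refine tsum_ite_eq_three hg (by simp) (by simp) (by simp [hne]) fun e he => ?_
  rw [down_eq_iff he]
  constructor
  · rintro (⟨h2, rfl⟩ | ⟨c, t, h1, h2, h3, rfl⟩)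
    · exact Or.inl rfl
    · obtain rfl : a = c := by omega
      rcases Int.units_eq_one_or t with rfl | rfl
      exacts [Or.inr (Or.inl rfl), Or.inr (Or.inr rfl)]
  · rintro (rfl | rfl | rfl)
    · exact Or.inl ⟨by omega, rfl⟩
    · exact Or.inr ⟨a, 1, rfl, rfl, rfl, rfl⟩
    · exact Or.inr ⟨a, -1, rfl, rfl, rfl, rfl⟩

theorem tsum_mul_transition (g : LatticeState → ℝ≥0∞) (d : LatticeState) :
    ∑' e, g e * transition e d = 2⁻¹ * ∑' e, g e * (if e.up = d then 1 else 0) +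
      2⁻¹ * ∑' e, g e * (if e.down = d then 1 else 0) := by
  rw [← ENNReal.tsum_mul_left, ← ENNReal.tsum_mul_left, ← ENNReal.tsum_add]
  exact tsum_congr fun e => by rw [transition]; ring

end Predecessors

/-! ### The flow of a law satisfying the conditions -/

section Flow

variable {h : ℝ} {m : Measure Quad}

/-- The flow through a lattice state. -/
noncomputable def flowAt (h : ℝ) (m : Measure Quad) (d : LatticeState) : ℝ :=
  if d.2.2.1 ≤ d.1 + d.2.1 then
    if d.2.2.2 = 1 then flowPlus h m d.1 d.2.1 d.2.2.1
    else flowMinus h m d.1 d.2.1 (d.1 + d.2.1 - d.2.2.1)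
  else 0

theorem flowAt_plus {a b u : ℕ} (hu : u ≤ a + b) :
    flowAt h m (a, b, u, 1) = flowPlus h m a b u := by
  simp [flowAt, hu]

theorem flowAt_minus {a b u v : ℕ} (huv : u + v = a + b) :
    flowAt h m (a, b, u, -1) = flowMinus h m a b v := by
  have hne : (-1 : ℤˣ) ≠ 1 := by decide
  have h1 : u ≤ a + b := by omega
  have h2 : a + b - u = v := by omega
  simp [flowAt, h1, hne, h2]

variable [IsProbabilityMeasure m]

theorem EmbeddingConditions.flowAt_nonneg (hh : 0 < h) (hc : EmbeddingConditions h m)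
    (d : LatticeState) : 0 ≤ flowAt h m d := by
  unfold flowAt
  split_ifs
  exacts [hc.flowPlus_nonneg hh _ _ _, hc.flowMinus_nonneg hh _ _ _, le_rfl]

theorem ofReal_balance {f μ c x y : ℝ} (hf : 0 ≤ f) (hμ : 0 ≤ μ) (hc : 0 ≤ c) (hx : 0 ≤ x)
    (hy : 0 ≤ y) (hbal : f + μ = c + (x / 2 + y / 2)) :
    ENNReal.ofReal f + ENNReal.ofReal μ =
      ENNReal.ofReal c + (2⁻¹ * ENNReal.ofReal x + 2⁻¹ * ENNReal.ofReal y) := by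
  have h2 : ∀ t : ℝ, 2⁻¹ * ENNReal.ofReal t = ENNReal.ofReal (t / 2) := by
    intro t
    rw [ENNReal.ofReal_div_of_pos two_pos, ENNReal.ofReal_ofNat, mul_comm, div_eq_mul_inv]
  rw [h2, h2, ← ENNReal.ofReal_add hf hμ, ← ENNReal.ofReal_add (by positivity) (by positivity),
    ← ENNReal.ofReal_add hc (by positivity), hbal]

/-- Within a cell the balance is the difference equation of the potential. At the entry level the
value beyond the cell is twice the entry flux, which `entryPlus_succ` and `entryMinus_succ`
distribute over the end flows of the two preceding cells. At the opposite end the value beyond the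
cell is `0`. -/
theorem EmbeddingConditions.isFlow (hh : 0 < h) (hc : EmbeddingConditions h m) :
    IsFlow (fun d => ENNReal.ofReal (flowAt h m d)) fun d => m {d.toQuad h} := by
  have hm := hc.lattice
  have hn := hc.flowAt_nonneg hh
  have hM : ∀ d : LatticeState, m {d.toQuad h} = ENNReal.ofReal (massAt h m d) := fun d =>
    (ofReal_measureReal).symm
  have hM0 : ∀ d : LatticeState, 0 ≤ massAt h m d := fun d => massAt_nonneg d
  have hinv : ∀ d : LatticeState, ¬d.Valid → ENNReal.ofReal (flowAt h m d) = 0 := by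
    intro d hd
    have : ¬(d.2.2.1 ≤ d.1 + d.2.1) := hd
    simp [flowAt, this]
  have hMinv : ∀ d : LatticeState, ¬d.Valid → m {d.toQuad h} = 0 := by
    intro d hd
    have : ∀ᵐ z ∂m, z ∉ ({d.toQuad h} : Set Quad) := by
      filter_upwards [hm] with z hz hzd
      obtain ⟨e, he, rfl⟩ := hz
      exact hd (toQuad_injective hh (Set.mem_singleton_iff.1 hzd) ▸ he)
    simp only [ae_iff, not_not] at this
    exact this
  refine ⟨fun d => by finiteness, fun d hd => by rw [hinv d hd, hMinv d hd, add_zero], ?_⟩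
  intro d
  have hδ : ((if d = origin then 1 else 0 : ℝ≥0∞)) =
      ENNReal.ofReal (if d = origin then 1 else 0) := by split_ifs <;> simp
  by_cases hd : d.Valid
  swap
  · rw [hinv d hd, hMinv d hd, add_zero, eq_comm, add_eq_zero]
    refine ⟨if_neg ?_, ENNReal.tsum_eq_zero.2 fun e => ?_⟩
    · rintro rfl
      exact hd (by simp [Valid, origin])
    · by_cases he : e.Valid
      · have h1 : e.up ≠ d := fun hx => hd (hx ▸ he.up)
        have h2 : e.down ≠ d := fun hx => hd (hx ▸ he.down)
        simp [transition, h1, h2]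
      · rw [hinv e he, zero_mul]
  rw [hδ, tsum_mul_transition]
  rw [hM]
  obtain ⟨a, b, u, s⟩ := d
  simp only [Valid] at hd
  have hne : (1 : ℤˣ) ≠ -1 := by decide
  rcases Int.units_eq_one_or s with rfl | rfl
  · have horigin : ((a, b, u, 1) : LatticeState) ≠ origin := by simp [origin, hne]
    rw [if_neg horigin]
    have hlast := flowPlus_last_succ hh hm a b
    cases u with
    | zero =>
      rw [(tsum_up_zero hinv _ _ _).trans ENNReal.ofReal_zero.symm]
      have hbal : flowPlus h m a b 0 + massAt h m (a, b, 0, 1) = flowPlus h m a b 1 / 2 :=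
        potential_balance_zero _ _
      by_cases hab : 1 ≤ a + b
      · rw [tsum_down_of_lt hinv (by omega) (by simp [hne])]
        refine ofReal_balance (hn _) (hM0 _) le_rfl le_rfl (hn _) ?_
        rw [flowAt_plus hd, flowAt_plus hab]
        linarith
      · obtain ⟨rfl, rfl⟩ : a = 0 ∧ b = 0 := by omega
        rw [(tsum_down_top hinv rfl).trans ENNReal.ofReal_zero.symm]
        refine ofReal_balance (hn _) (hM0 _) le_rfl le_rfl le_rfl ?_
        rw [entryPlus_zero_right hh hm] at hlast
        rw [flowAt_plus hd]
        simp only [add_zero, zero_add] at hlast hbal ⊢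
        linarith
    | succ v =>
      have hbal : flowPlus h m a b (v + 1) + massAt h m (a, b, v + 1, 1) =
        flowPlus h m a b v / 2 + flowPlus h m a b (v + 2) / 2 := potential_balance_succ _ _ _
      by_cases hv : v + 1 < a + b
      · rw [tsum_up_succ hinv hd (by omega), tsum_down_of_lt hinv hv (by simp [hne])]
        refine ofReal_balance (hn _) (hM0 _) le_rfl (hn _) (hn _) ?_
        rw [flowAt_plus hd, flowAt_plus (by omega), flowAt_plus hv]
        linarith
      · have hv' : v + 1 = a + b := by omega
        rw [← hv'] at hlast
        rw [(tsum_down_top hinv hv').trans ENNReal.ofReal_zero.symm]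
        cases b with
        | zero =>
          rw [tsum_up_succ hinv hd (by simp)]
          refine ofReal_balance (hn _) (hM0 _) le_rfl (hn _) le_rfl ?_
          rw [entryPlus_zero_right hh hm] at hlast
          rw [flowAt_plus hd, flowAt_plus (by omega)]
          linarith
        | succ b =>
          obtain rfl : v = a + b := by omega
          rw [tsum_up_top hinv, ← ENNReal.ofReal_add (hn _) (hn _),
            ← ENNReal.ofReal_add (hn _) (add_nonneg (hn _) (hn _))]
          refine ofReal_balance (hn _) (hM0 _) le_rfl
            (add_nonneg (hn _) (add_nonneg (hn _) (hn _))) le_rfl ?_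
          -- The minus flow is read from the maximum downwards, so its index `0` is the top level,
          -- from which half goes to the new maximum.
          have h0 : flowMinus h m a b 0 = 2 * exitUp h m a b := potential_zero _ _
          rw [entryPlus_succ hh hm] at hlast
          rw [flowAt_plus hd, flowAt_plus (by omega), flowAt_plus le_rfl,
            flowAt_minus (v := 0) (by omega), h0, flowPlus_last hh hm]
          linarith
  · have hlast := flowMinus_last_succ hh hm a b
    obtain ⟨v, hv⟩ : ∃ v, u + v = a + b := ⟨a + b - u, by omega⟩
    have hmass : massAt h m (a, b, a + b - v, -1) = massAt h m (a, b, u, -1) := by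
      rw [show a + b - v = u by omega]
    cases v with
    | zero =>
      have hbal : flowMinus h m a b 0 + massAt h m (a, b, a + b - 0, -1) =
        flowMinus h m a b 1 / 2 := potential_balance_zero _ _
      rw [hmass] at hbal
      rw [(tsum_down_top hinv (by omega)).trans ENNReal.ofReal_zero.symm]
      cases u with
      | zero =>
        obtain ⟨rfl, rfl⟩ : a = 0 ∧ b = 0 := by omega
        rw [(tsum_up_zero hinv _ _ _).trans ENNReal.ofReal_zero.symm,
          if_pos (show ((0, 0, 0, -1) : LatticeState) = origin from rfl)]
        -- At the origin the boundary value is `2`, and its half is the unit source of the flow.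
        refine ofReal_balance (hn _) (hM0 _) zero_le_one le_rfl le_rfl ?_
        rw [entryMinus_zero_left hh hm, if_pos rfl] at hlast
        rw [flowAt_minus (v := 0) rfl]
        simp only [add_zero, zero_add] at hlast hbal ⊢
        linarith
      | succ u =>
        rw [if_neg (by simp [origin]), tsum_up_succ hinv hd (by simp [hne.symm])]
        refine ofReal_balance (hn _) (hM0 _) le_rfl (hn _) le_rfl ?_
        rw [flowAt_minus hv, flowAt_minus (v := 1) (by omega)]
        linarith
    | succ v =>
      have hbal : flowMinus h m a b (v + 1) + massAt h m (a, b, a + b - (v + 1), -1) =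
        flowMinus h m a b v / 2 + flowMinus h m a b (v + 2) / 2 := potential_balance_succ _ _ _
      rw [hmass] at hbal
      cases u with
      | succ u =>
        rw [if_neg (by simp [origin]), tsum_up_succ hinv hd (by simp [hne.symm]),
          tsum_down_of_lt hinv (by omega) (by simp)]
        refine ofReal_balance (hn _) (hM0 _) le_rfl (hn _) (hn _) ?_
        rw [flowAt_minus hv, flowAt_minus (v := v + 2) (by omega), flowAt_minus (v := v) (by omega)]
        linarith
      | zero =>
        have hv' : v + 1 = a + b := by omega
        rw [← hv'] at hlast
        rw [(tsum_up_zero hinv _ _ _).trans ENNReal.ofReal_zero.symm]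
        cases a with
        | zero =>
          have hb : b ≠ 0 := by omega
          rw [if_neg (by simp [origin, hb]), tsum_down_of_lt hinv (by omega) (by simp)]
          refine ofReal_balance (hn _) (hM0 _) le_rfl le_rfl (hn _) ?_
          rw [entryMinus_zero_left hh hm, if_neg hb] at hlast
          rw [flowAt_minus hv, flowAt_minus (v := v) (by omega)]
          linarith
        | succ a =>
          rw [if_neg (by simp [origin]), tsum_down_bottom hinv,
            ← ENNReal.ofReal_add (hn _) (hn _),
            ← ENNReal.ofReal_add (hn _) (add_nonneg (hn _) (hn _))]
          refine ofReal_balance (hn _) (hM0 _) le_rfl le_rfl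
            (add_nonneg (hn _) (add_nonneg (hn _) (hn _))) ?_
          have h0 : flowPlus h m a b 0 = 2 * exitDown h m a b := potential_zero _ _
          rw [entryMinus_succ hh hm] at hlast
          rw [flowAt_minus hv, flowAt_minus (v := v) (by omega), flowAt_plus (by omega),
            flowAt_minus (v := a + b) (by omega), h0, flowMinus_last hh hm]
          linarith

end Flow

end StoppedWalk

/-! ### The equivalence -/

theorem theorem1 (h : ℝ) (hh : 0 < h)
    (m : MeasureTheory.Measure StoppedWalk.Quad) [MeasureTheory.IsProbabilityMeasure m]
    (hm : ∀ᵐ z ∂m, z ∈ StoppedWalk.stateSpace h) :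
    StoppedWalk.IsConsistent.{u} h m ↔
      (∀ᵐ z ∂m, z.I ≤ z.X ∧ z.X ≤ z.S) ∧
      (∀ i j : ℕ, ¬ (i = 0 ∧ j = 0) →
        StoppedWalk.CondPlus h m (i * h) (j * h) ∧ StoppedWalk.CondMinus h m (i * h) (j * h)) ∧
      m (StoppedWalk.cell 0 0 1) = 0 := by
  refine ⟨fun hc => hc.conditions hh, fun ⟨h1, h2, h3⟩ => ?_⟩
  have hl : ∀ᵐ z ∂m, ∃ d : StoppedWalk.LatticeState, d.Valid ∧ d.toQuad h = z := by
    filter_upwards [hm, h1] with z hz hz'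
    exact (StoppedWalk.exists_valid_toQuad_iff hh z).2 ⟨hz, hz'⟩
  exact (StoppedWalk.EmbeddingConditions.isFlow hh ⟨hl, h2, h3⟩).isConsistent hh hl
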